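/- **Proposition 4.2 (Verifying RE for $\hat\Gamma$).** *Setting.* Let $p,d\ge 1$ and let $\{X^t\}_{t\in\mathbb Z}$ be a $p$-dimensional covariance-stationary VAR($d$) process $$X^t = A_1X^{t-1}+\dots+A_dX^{t-d}+\varepsilon^t,\qquad \varepsilon^t \overset{\text{i.i.d.}}{\sim} N(0,\Sigma_\varepsilon),$$ with real $p\times p$ matrices $A_1,\dots,A_d$ and $\Sigma_\varepsilon$ positive definite. Assume that it is stable: with $\mathcal A(z)=I_p-\sum_{t=1}^d A_tz^t$, $\det\mathcal A(z)\ne 0$ for all complex $z$ with $|z|=1$. Let $k$ be the total number of nonzero entries of $A_1,\dots,A_d$. From $X^0,\dots,X^T$, $T\ge d$, put $N=T-d+1$ and let $\mathcal X$ be the $N\times dp$ matrix with rows $((X^{t-1})',\dots,(X^{t-d})')$, $t=T,T-1,\dots,d$. Write $\Lambda_{\min},\Lambda_{\max}$ for the extreme eigenvalues of a Hermitian matrix, and $$\mu_{\min}(\mathcal A)=\min_{|z|=1}\Lambda_{\min}(\mathcal A^*(z)\mathcal A(z)),\qquad \mu_{\max}(\mathcal A)=\max_{|z|=1}\Lambda_{\max}(\mathcal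 A^*(z)\mathcal A(z)).$$ Let $\tilde A_1$ be the $dp\times dp$ companion matrix with first block row $(A_1,\dots,A_d)$, blocks $I_p$ directly below the block diagonal and zeros elsewhere. Put $\tilde{\mathcal A}(z)=I_{dp}-\tilde A_1z$, and define $\mu_{\min}(\tilde{\mathcal A})$ in the same way. A symmetric matrix $\Gamma\in\mathbb R^{q\times q}$ satisfies $\mathrm{RE}(\alpha,\tau)$, where $\alpha>0$ and $\tau\ge0$, if $$\theta'\Gamma\theta\ \ge\ \alpha\|\theta\|_2^2-\tau\|\theta\|_1^2\qquad\text{for all }\theta\in\mathbb R^q .$$ *Claim.* There are absolute constants $c_0,c_1,c_2,c_3>0$, independent of all model parameters, such that the following holds for every process and every $T$ as above. Put $$\omega=c_3\,\frac{\Lambda_{\max}(\Sigma_\varepsilon)/\mu_{\min}(\tilde{\mathcal A})}{\Lambda_{\min}(\Sigma_\varepsilon)/\mu_{\max}(\mathcal A)},\qquad \alpha=\frac{\Lambda_{\min}(\Sigma_\varepsilon)}{2\mu_{\max}(\mathcal A)},\qquad \tau=\alpha\max\{\omega^2,1\}\,\frac{\log d+\log p}{N}.$$ If $N\ge c_0\max\{\omega^2,1\}\,k(\log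 d+\log p)$, then with probability at least $1-c_1\exp(-c_2N\min\{\omega^{-2},1\})$, $$I_p\otimes(\mathcal X'\mathcal X/N)\ \text{ satisfies }\ \mathrm{RE}(\alpha,\tau).$$ If moreover $\Sigma_\varepsilon^{-1}=(\sigma_\varepsilon^{ij})$ is strictly diagonally dominant, that is, $\bar\sigma_\varepsilon^i:=\sigma_\varepsilon^{ii}-\sum_{j\ne i}|\sigma_\varepsilon^{ij}|>0$ for $i=1,\dots,p$, then with probability at least the same bound, $$\Sigma_\varepsilon^{-1}\otimes(\mathcal X'\mathcal X/N)\ \text{ satisfies }\ \mathrm{RE}\Bigl(\alpha\min_i\bar\sigma_\varepsilon^i,\ \tau\max_i\bar\sigma_\varepsilon^i\Bigr).$$ -/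

import Mathlib

open MeasureTheory ProbabilityTheory
open scoped Kronecker Matrix

noncomputable section

namespace SparseVAR

/-- The smallest eigenvalue of a (real symmetric or complex) Hermitian matrix. -/
def lambdaMin {𝕜 n : Type*} [RCLike 𝕜] [Fintype n] [DecidableEq n]
    {M : Matrix n n 𝕜} (hM : M.IsHermitian) : ℝ :=
  ⨅ i, hM.eigenvalues i

/-- The largest eigenvalue of a (real symmetric or complex) Hermitian matrix. -/
def lambdaMax {𝕜 n : Type*} [RCLike 𝕜] [Fintype n] [DecidableEq n]
    {M : Matrix n n 𝕜} (hM : M.IsHermitian) : ℝ :=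
  ⨆ i, hM.eigenvalues i

/-- The reverse characteristic polynomial `I - A₁ z - ⋯ - A_d z ^ d` of a VAR(`d`) model, as a
matrix-valued function of `z`.  The matrix `A_{h+1}` is `A h`, for `h = 0, …, d - 1`. -/
def revCharPoly {n : Type*} [DecidableEq n] {d : ℕ}
    (A : Fin d → Matrix n n ℝ) (z : ℂ) : Matrix n n ℂ :=
  1 - ∑ h : Fin d, z ^ ((h : ℕ) + 1) • (A h).map (fun x : ℝ => (x : ℂ))

/-- Stability: the determinant of the reverse characteristic polynomial has no zero on the
unit circle. -/
def IsStable {n : Type*} [Fintype n] [DecidableEq n] {d : ℕ}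
    (A : Fin d → Matrix n n ℝ) : Prop :=
  ∀ z : ℂ, ‖z‖ = 1 → (revCharPoly A z).det ≠ 0

/-- The minimum over the unit circle of the smallest eigenvalue of `𝒜(z)* 𝒜(z)`. -/
def muMin {n : Type*} [Fintype n] [DecidableEq n] {d : ℕ} (A : Fin d → Matrix n n ℝ) : ℝ :=
  ⨅ z : Circle, lambdaMin (Matrix.isHermitian_conjTranspose_mul_self (revCharPoly A (z : ℂ)))

/-- The maximum over the unit circle of the largest eigenvalue of `𝒜(z)* 𝒜(z)`. -/
def muMax {n : Type*} [Fintype n] [DecidableEq n] {d : ℕ} (A : Fin d → Matrix n n ℝ) : ℝ :=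
  ⨆ z : Circle, lambdaMax (Matrix.isHermitian_conjTranspose_mul_self (revCharPoly A (z : ℂ)))

/-- The `dp × dp` companion matrix: first block row `A₁, …, A_d`, identity blocks below the
block diagonal, zeros elsewhere.  An index is a pair (block, coordinate). -/
def companion {p d : ℕ} (A : Fin d → Matrix (Fin p) (Fin p) ℝ) :
    Matrix (Fin d × Fin p) (Fin d × Fin p) ℝ :=
  Matrix.of fun a b =>
    if (a.1 : ℕ) = 0 then A b.1 a.2 b.2
    else if (a.1 : ℕ) = (b.1 : ℕ) + 1 ∧ a.2 = b.2 then 1 else 0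

/-- The companion matrix as the coefficient of the equivalent `dp`-dimensional VAR(1) model. -/
def companionVAR {p d : ℕ} (A : Fin d → Matrix (Fin p) (Fin p) ℝ) :
    Fin 1 → Matrix (Fin d × Fin p) (Fin d × Fin p) ℝ :=
  fun _ => companion A

/-- The number of nonzero entries of all the transition matrices together. -/
def sparsity {p d : ℕ} (A : Fin d → Matrix (Fin p) (Fin p) ℝ) : ℕ :=
  ∑ h : Fin d, (Finset.univ.filter fun ij : Fin p × Fin p => A h ij.1 ij.2 ≠ 0).card

/-- Covariance stationarity of a vector-valued process indexed by `ℤ`. -/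
structure IsCovStationary {Ω : Type*} [MeasurableSpace Ω] {p : ℕ}
    (X : ℤ → Ω → EuclideanSpace ℝ (Fin p)) (P : Measure Ω) : Prop where
  memLp : ∀ t, MemLp (X t) 2 P
  mean_eq : ∀ s t, ∫ ω, X s ω ∂P = ∫ ω, X t ω ∂P
  cov_eq : ∀ s t h : ℤ, ∀ i j : Fin p,
    cov[fun ω => X s ω i, fun ω => X (s + h) ω j; P] =
      cov[fun ω => X t ω i, fun ω => X (t + h) ω j; P]

/-- `X` is a stationary VAR(`d`) process with transition matrices `A` and innovations `ε`,
which are independent with common law `N(0, Sig)`. -/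
structure IsVARProcess {Ω : Type*} [MeasurableSpace Ω] {p d : ℕ}
    (A : Fin d → Matrix (Fin p) (Fin p) ℝ) (Sig : Matrix (Fin p) (Fin p) ℝ)
    (X ε : ℤ → Ω → EuclideanSpace ℝ (Fin p)) (P : Measure Ω) : Prop where
  stationary : IsCovStationary X P
  innovation_law : ∀ t, HasLaw (ε t) (multivariateGaussian 0 Sig) P
  innovation_indep : iIndepFun ε P
  equation : ∀ t : ℤ, ∀ᵐ ω ∂P, ∀ i : Fin p,
    X t ω i =
      (∑ h : Fin d, (A h *ᵥ (fun j => X (t - ((h : ℕ) + 1 : ℤ)) ω j)) i) + ε t ω i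

/-- The number `N = T - d + 1` of rows of the regression; it is used only for `d ≤ T`. -/
def numSamples (d T : ℕ) : ℕ := T - d + 1

/-- The `N × dp` design matrix built from a path `x`.  Its rows are
`((x^{T-1})', …, (x^{T-d})'), …, ((x^{d-1})', …, (x^0)')`. -/
def designMatrix {p : ℕ} (d T : ℕ) (x : ℤ → EuclideanSpace ℝ (Fin p)) :
    Matrix (Fin (numSamples d T)) (Fin d × Fin p) ℝ :=
  Matrix.of fun r b => x ((T : ℤ) - 1 - (r : ℕ) - ((b.1 : ℕ) : ℤ)) b.2

/-- The Gram matrix `𝒳'𝒳 / N`. -/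
def gram {p : ℕ} (d T : ℕ) (x : ℤ → EuclideanSpace ℝ (Fin p)) :
    Matrix (Fin d × Fin p) (Fin d × Fin p) ℝ :=
  (numSamples d T : ℝ)⁻¹ • ((designMatrix d T x)ᵀ * designMatrix d T x)

/-- The restricted eigenvalue condition with curvature `α` and tolerance `τ`.  The tolerance
`τ = 0` is admitted, so that the case of a single scalar regressor is covered as well. -/
structure RE {q : Type*} [Fintype q] (G : Matrix q q ℝ) (α τ : ℝ) : Prop where
  symm : G.IsSymm
  curvature_pos : 0 < α
  tolerance_nonneg : 0 ≤ τ
  lower : ∀ θ : q → ℝ,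
    α * ∑ i, θ i ^ 2 - τ * (∑ i, |θ i|) ^ 2 ≤ θ ⬝ᵥ (G *ᵥ θ)

/-- `ω = c₃ (Λ_max(Sig) / μ_min(𝒜̃)) / (Λ_min(Sig) / μ_max(𝒜))`. -/
def omegaVAR {p d : ℕ} (c₃ : ℝ) (A : Fin d → Matrix (Fin p) (Fin p) ℝ)
    {Sig : Matrix (Fin p) (Fin p) ℝ} (hSig : Sig.IsHermitian) : ℝ :=
  c₃ * ((lambdaMax hSig / muMin (companionVAR A)) / (lambdaMin hSig / muMax A))

/-- `α = Λ_min(Sig) / (2 μ_max(𝒜))`. -/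
def alphaVAR {p d : ℕ} (A : Fin d → Matrix (Fin p) (Fin p) ℝ)
    {Sig : Matrix (Fin p) (Fin p) ℝ} (hSig : Sig.IsHermitian) : ℝ :=
  lambdaMin hSig / (2 * muMax A)

/-- `τ = α max{ω², 1} (log d + log p) / N`. -/
def tauVAR {p d : ℕ} (c₃ : ℝ) (T : ℕ) (A : Fin d → Matrix (Fin p) (Fin p) ℝ)
    {Sig : Matrix (Fin p) (Fin p) ℝ} (hSig : Sig.IsHermitian) : ℝ :=
  alphaVAR A hSig * max (omegaVAR c₃ A hSig ^ 2) 1 *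
    ((Real.log d + Real.log p) / (numSamples d T : ℝ))

/-- The diagonal-dominance margin `W i i - ∑_{j ≠ i} |W i j|` of the `i`-th row of `W`. -/
def rowMargin {p : ℕ} (W : Matrix (Fin p) (Fin p) ℝ) (i : Fin p) : ℝ :=
  W i i - ∑ j ∈ Finset.univ.erase i, |W i j|

end SparseVAR

end

set_option linter.unusedSectionVars false

/-! Write b = Λ_min(Sig)/μ_max(𝒜), B = Λ_max(Sig)/μ_min(𝒜̃) and Γ for the Gram matrix. Everything
rests on two variance bounds: each entry of 𝒳v is centred Gaussian with variance at least b‖v‖², and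
each u'𝒳v is centred Gaussian with variance at most B‖u‖²‖v‖².

Both come from one argument, which needs neither a spectral density nor a causal expansion. For a
functional ∑ w_t·X_t, solve the adjoint lag equation for g with right-hand side w on a long cycle
`ZMod M`. The discrete Fourier transform diagonalises that equation, so the bounds on the unit
circle control ‖g‖² uniformly in M. Cutting the cycle where g is small and summing by parts turns
the functional into ∑ g_t·ε_t plus a boundary term that is small in L¹. Letting the cycle grow
identifies the law (`exists_lagAdjoint_eq`, `IsGaussianAutoregression.exists_map_eq_gaussianReal`).
The lower bound uses the VAR(d) model; the upper bound uses its companion VAR(1) model, whose states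
are the rows of 𝒳.

A Chernoff bound in the eigenbasis of the covariance of 𝒳v then gives a deviation of at most ηB‖v‖²
for v'Γv, up to probability exp(-Nη²/8) on each side (`norm_sq_concentration`). The choice η =
b/(4B) makes the deviation b‖v‖²/4.

Uniformity over θ comes from Maurey's empirical method instead of nets. The vector θ/‖θ‖₁ is an
average of signed basis vectors. If D = Γ - EΓ + (b/4)I has a nonnegative form at all sums of m such
vectors, then (m-1)θ'Dθ ≥ -c‖θ‖₁², where c bounds the diagonal of D
(`neg_mul_le_of_forall_signedSingle`). This needs only (2dp)^m + dp events, and m of order N/(ω²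
log(dp)) balances tolerance against probability. Finally, diagonal dominance carries RE from Γ to W
⊗ Γ (`RE.kronecker`), with W = I as a special case. -/

namespace SparseVAR

/-! ### Hermitian quadratic forms and extreme eigenvalues -/

section Rayleigh

variable {𝕜 n : Type*} [RCLike 𝕜] [Fintype n] [DecidableEq n]

/-- The quadratic form of a Hermitian matrix in the coordinates of its eigenbasis. -/
lemma exists_quadForm_eq_sum_eigenvalues {M : Matrix n n 𝕜} (hM : M.IsHermitian) (x : n → 𝕜) :
    ∃ y : n → ℝ, (∀ i, 0 ≤ y i) ∧ ∑ i, y i = ∑ i, ‖x i‖ ^ 2 ∧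
      RCLike.re (star x ⬝ᵥ (M *ᵥ x)) = ∑ i, hM.eigenvalues i * y i := by
  set b := hM.eigenvectorBasis with hb
  set X : EuclideanSpace 𝕜 n := WithLp.toLp 2 x with hX
  refine ⟨fun i => ‖inner 𝕜 (b i) X‖ ^ 2, fun i => by positivity, ?_, ?_⟩
  · rw [b.sum_sq_norm_inner_right, EuclideanSpace.norm_sq_eq]
  · have h1 : star x ⬝ᵥ (M *ᵥ x) = inner 𝕜 X (WithLp.toLp 2 (M *ᵥ x) : EuclideanSpace 𝕜 n) := by
      rw [EuclideanSpace.inner_eq_star_dotProduct, dotProduct_comm]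
    rw [h1, ← b.sum_inner_mul_inner, map_sum]
    refine Finset.sum_congr rfl fun i _ => ?_
    have h2 : inner 𝕜 (b i) (WithLp.toLp 2 (M *ᵥ x) : EuclideanSpace 𝕜 n) =
        (hM.eigenvalues i : 𝕜) * inner 𝕜 (b i) X := by
      rw [EuclideanSpace.inner_eq_star_dotProduct, EuclideanSpace.inner_eq_star_dotProduct]
      change (M *ᵥ x) ⬝ᵥ star (b i).ofLp = _ * (x ⬝ᵥ star (b i).ofLp)
      have h3 := hM.mulVec_eigenvectorBasis i
      have h4 : star (b i).ofLp ᵥ* M = (hM.eigenvalues i : 𝕜) • star (b i).ofLp := by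
        have := congrArg star h3
        rw [Matrix.star_mulVec, hM.eq] at this
        rw [this]
        ext j
        simp [hb, RCLike.real_smul_eq_coe_mul]
      rw [dotProduct_comm, Matrix.dotProduct_mulVec, h4, smul_dotProduct, smul_eq_mul,
        dotProduct_comm]
    rw [h2, mul_left_comm, ← inner_conj_symm X (b i), RCLike.conj_mul]
    rw [← RCLike.ofReal_pow, ← RCLike.ofReal_mul, RCLike.ofReal_re]

lemma lambdaMin_mul_le {M : Matrix n n 𝕜} (hM : M.IsHermitian) (x : n → 𝕜) :
    lambdaMin hM * ∑ i, ‖x i‖ ^ 2 ≤ RCLike.re (star x ⬝ᵥ (M *ᵥ x)) := by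
  obtain ⟨y, hy, hsum, hq⟩ := exists_quadForm_eq_sum_eigenvalues hM x
  rw [hq, ← hsum, Finset.mul_sum]
  exact Finset.sum_le_sum fun i _ => mul_le_mul_of_nonneg_right
    (ciInf_le (Set.finite_range _).bddBelow i) (hy i)

lemma le_lambdaMax_mul {M : Matrix n n 𝕜} (hM : M.IsHermitian) (x : n → 𝕜) :
    RCLike.re (star x ⬝ᵥ (M *ᵥ x)) ≤ lambdaMax hM * ∑ i, ‖x i‖ ^ 2 := by
  obtain ⟨y, hy, hsum, hq⟩ := exists_quadForm_eq_sum_eigenvalues hM x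
  rw [hq, ← hsum, Finset.mul_sum]
  exact Finset.sum_le_sum fun i _ => mul_le_mul_of_nonneg_right
    (le_ciSup (Set.finite_range _).bddAbove i) (hy i)

lemma re_star_dotProduct_conjTranspose_mul_self (B : Matrix n n 𝕜) (x : n → 𝕜) :
    RCLike.re (star x ⬝ᵥ ((Bᴴ * B) *ᵥ x)) = ∑ i, ‖(B *ᵥ x) i‖ ^ 2 := by
  rw [← Matrix.mulVec_mulVec, Matrix.dotProduct_mulVec, ← Matrix.star_mulVec, dotProduct, map_sum]
  refine Finset.sum_congr rfl fun i _ => ?_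
  simp only [Pi.star_apply, RCLike.star_def, RCLike.conj_mul]
  rw [← RCLike.ofReal_pow, RCLike.ofReal_re]

lemma sum_norm_sq_mulVec_le (B : Matrix n n 𝕜) (x : n → 𝕜) :
    ∑ i, ‖(B *ᵥ x) i‖ ^ 2 ≤ (∑ i, ∑ j, ‖B i j‖ ^ 2) * ∑ i, ‖x i‖ ^ 2 := by
  rw [Finset.sum_mul]
  refine Finset.sum_le_sum fun i _ => ?_
  calc ‖(B *ᵥ x) i‖ ^ 2 ≤ (∑ j, ‖B i j‖ * ‖x j‖) ^ 2 := by
        gcongr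
        exact (norm_sum_le _ _).trans (by simp)
    _ ≤ _ := Finset.sum_mul_sq_le_sq_mul_sq _ _ _

/-- Every eigenvalue of `Bᴴ B` is a value of the quadratic form at a unit vector. -/
lemma exists_eigenvalues_conjTranspose_mul_self_eq (B : Matrix n n 𝕜) (i : n) :
    ∃ x : n → 𝕜, ∑ j, ‖x j‖ ^ 2 = 1 ∧
      (Matrix.isHermitian_conjTranspose_mul_self B).eigenvalues i = ∑ j, ‖(B *ᵥ x) j‖ ^ 2 := by
  set hM := Matrix.isHermitian_conjTranspose_mul_self B
  refine ⟨(hM.eigenvectorBasis i).ofLp, ?_, ?_⟩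
  · rw [← EuclideanSpace.norm_sq_eq, hM.eigenvectorBasis.orthonormal.1 i, one_pow]
  · rw [hM.eigenvalues_eq i, re_star_dotProduct_conjTranspose_mul_self]

end Rayleigh

/-! ### Bounds for the lag polynomial on the unit circle -/

section Circle

variable {n : Type*} [Fintype n] [DecidableEq n] {d : ℕ}

lemma continuous_revCharPoly (A : Fin d → Matrix n n ℝ) :
    Continuous fun z : Circle => revCharPoly A (z : ℂ) := by
  unfold revCharPoly
  fun_prop

lemma muMin_mul_le (A : Fin d → Matrix n n ℝ) (z : Circle) (x : n → ℂ) :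
    muMin A * ∑ i, ‖x i‖ ^ 2 ≤ ∑ i, ‖(revCharPoly A (z : ℂ) *ᵥ x) i‖ ^ 2 := by
  rw [← re_star_dotProduct_conjTranspose_mul_self]
  refine le_trans ?_ (lambdaMin_mul_le (Matrix.isHermitian_conjTranspose_mul_self _) x)
  refine mul_le_mul_of_nonneg_right (ciInf_le ⟨0, ?_⟩ z) (by positivity)
  rintro _ ⟨w, rfl⟩
  exact Real.iInf_nonneg fun i => Matrix.eigenvalues_conjTranspose_mul_self_nonneg _ i

lemma le_muMax_mul (A : Fin d → Matrix n n ℝ) (z : Circle) (x : n → ℂ) :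
    ∑ i, ‖(revCharPoly A (z : ℂ) *ᵥ x) i‖ ^ 2 ≤ muMax A * ∑ i, ‖x i‖ ^ 2 := by
  rw [← re_star_dotProduct_conjTranspose_mul_self]
  refine (le_lambdaMax_mul (Matrix.isHermitian_conjTranspose_mul_self _) x).trans ?_
  refine mul_le_mul_of_nonneg_right (le_ciSup (f := fun z : Circle =>
    lambdaMax (Matrix.isHermitian_conjTranspose_mul_self (revCharPoly A (z : ℂ)))) ?_ z)
    (by positivity)
  have hcont : Continuous fun z : Circle => ∑ i, ∑ j, ‖revCharPoly A (z : ℂ) i j‖ ^ 2 := by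
    refine continuous_finsetSum _ fun i _ => continuous_finsetSum _ fun j _ => ?_
    exact ((continuous_revCharPoly A).matrix_elem i j).norm.pow 2
  obtain ⟨K, hK⟩ := (isCompact_range hcont).bddAbove
  -- The index type may be empty, in which case the supremum is 0; hence a nonnegative bound.
  refine ⟨max K 0, ?_⟩
  rintro _ ⟨w, rfl⟩
  refine Real.iSup_le (fun i => ?_) (le_max_right _ _)
  obtain ⟨x, hx, he⟩ := exists_eigenvalues_conjTranspose_mul_self_eq (revCharPoly A (w : ℂ)) i
  rw [he]
  refine (sum_norm_sq_mulVec_le _ x).trans ?_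
  rw [hx, mul_one]
  exact (hK ⟨w, rfl⟩).trans (le_max_left _ _)

/-- On the compact circle the inverse of 𝒜(z) is continuous, so its squared Frobenius norm is
bounded by some K. Then 1 = ‖x‖² ≤ K‖𝒜(z)x‖² keeps all eigenvalues of 𝒜*𝒜 away from 0. -/
lemma muMin_pos [Nonempty n] {A : Fin d → Matrix n n ℝ} (hA : IsStable A) : 0 < muMin A := by
  have hdet : ∀ z : Circle, (revCharPoly A (z : ℂ)).det ≠ 0 := fun z => hA z z.norm_coe
  have hcont : Continuous fun z : Circle => ∑ i, ∑ j, ‖(revCharPoly A (z : ℂ))⁻¹ i j‖ ^ 2 := by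
    have h0 : Continuous fun z : Circle => (revCharPoly A (z : ℂ))⁻¹ := by
      simp only [Matrix.inv_def, Ring.inverse_eq_inv']
      exact ((continuous_revCharPoly A).matrix_det.inv₀ hdet).smul
        (continuous_revCharPoly A).matrix_adjugate
    refine continuous_finsetSum _ fun i _ => continuous_finsetSum _ fun j _ => ?_
    exact (h0.matrix_elem i j).norm.pow 2
  obtain ⟨K, hK⟩ := (isCompact_range hcont).bddAbove
  have hKpos : 0 < max K 1 := lt_of_lt_of_le one_pos (le_max_right _ _)
  refine lt_of_lt_of_le (inv_pos.2 hKpos) (le_ciInf fun z => le_ciInf fun i => ?_)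
  obtain ⟨x, hx, he⟩ := exists_eigenvalues_conjTranspose_mul_self_eq (revCharPoly A (z : ℂ)) i
  rw [he]
  have h := sum_norm_sq_mulVec_le (revCharPoly A (z : ℂ))⁻¹ (revCharPoly A (z : ℂ) *ᵥ x)
  rw [Matrix.mulVec_mulVec, Matrix.nonsing_inv_mul _ (isUnit_iff_ne_zero.2 (hdet z)),
    Matrix.one_mulVec, hx] at h
  have h2 : (∑ i, ∑ j, ‖(revCharPoly A (z : ℂ))⁻¹ i j‖ ^ 2) ≤ max K 1 :=
    (hK ⟨z, rfl⟩).trans (le_max_left _ _)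
  rw [inv_le_iff_one_le_mul₀' hKpos]
  exact h.trans (mul_le_mul_of_nonneg_right h2 (by positivity))

end Circle

/-! ### Passing norm bounds to the adjoint matrix -/

section Adjoint

variable {n : Type*} [Fintype n] [DecidableEq n]

lemma re_star_dotProduct_sq_le (x y : n → ℂ) :
    (star x ⬝ᵥ y).re ^ 2 ≤ (∑ i, ‖x i‖ ^ 2) * ∑ i, ‖y i‖ ^ 2 := by
  have h : |(star x ⬝ᵥ y).re| ≤ ∑ i, ‖x i‖ * ‖y i‖ :=
    (Complex.abs_re_le_norm _).trans ((norm_sum_le _ _).trans (by simp))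
  rw [← sq_abs]
  exact (pow_le_pow_left₀ (abs_nonneg _) h 2).trans (Finset.sum_mul_sq_le_sq_mul_sq _ _ _)

lemma re_star_dotProduct_self (x : n → ℂ) : (star x ⬝ᵥ x).re = ∑ i, ‖x i‖ ^ 2 := by
  rw [dotProduct, Complex.re_sum]
  refine Finset.sum_congr rfl fun i _ => ?_
  simp only [Pi.star_apply, RCLike.star_def, Complex.conj_mul']
  norm_cast

/-- A lower bound for an invertible matrix is a lower bound for its adjoint. -/
lemma mul_le_conjTranspose_mulVec {B : Matrix n n ℂ} (hB : B.det ≠ 0) {c : ℝ} (hc : 0 < c)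
    (h : ∀ x, c * ∑ i, ‖x i‖ ^ 2 ≤ ∑ i, ‖(B *ᵥ x) i‖ ^ 2) (x : n → ℂ) :
    c * ∑ i, ‖x i‖ ^ 2 ≤ ∑ i, ‖(Bᴴ *ᵥ x) i‖ ^ 2 := by
  -- Since ⟨Bᴴx, y⟩ = ‖x‖² and c‖y‖² ≤ ‖x‖², Cauchy–Schwarz bounds ‖Bᴴx‖ from below.
  set y := B⁻¹ *ᵥ x with hy
  have hxy : B *ᵥ y = x := by
    rw [hy, Matrix.mulVec_mulVec, Matrix.mul_nonsing_inv _ (isUnit_iff_ne_zero.2 hB),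
      Matrix.one_mulVec]
  have h1 := h y
  rw [hxy] at h1
  have h2 : star (Bᴴ *ᵥ x) ⬝ᵥ y = star x ⬝ᵥ x := by
    rw [Matrix.star_mulVec, Matrix.conjTranspose_conjTranspose, ← Matrix.dotProduct_mulVec, hxy]
  have h3 := re_star_dotProduct_sq_le (Bᴴ *ᵥ x) y
  rw [h2, re_star_dotProduct_self] at h3
  set a := ∑ i, ‖x i‖ ^ 2
  set e := ∑ i, ‖(Bᴴ *ᵥ x) i‖ ^ 2
  set f := ∑ i, ‖y i‖ ^ 2
  have ha : 0 ≤ a := by positivity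
  have he : 0 ≤ e := by positivity
  rcases ha.eq_or_lt with h0 | h0
  · rw [← h0, mul_zero]; exact he
  · have : c * a * a ≤ e * a := by
      calc c * a * a = c * a ^ 2 := by ring
        _ ≤ c * (e * f) := by gcongr
        _ = e * (c * f) := by ring
        _ ≤ e * a := by gcongr
    exact le_of_mul_le_mul_right this h0

/-- Cauchy–Schwarz for ‖Bᴴx‖² = ⟨x, BBᴴx⟩, followed by division by ‖Bᴴx‖². -/
lemma conjTranspose_mulVec_le_mul {B : Matrix n n ℂ} {c : ℝ} (hc : 0 ≤ c)
    (h : ∀ x, ∑ i, ‖(B *ᵥ x) i‖ ^ 2 ≤ c * ∑ i, ‖x i‖ ^ 2) (x : n → ℂ) :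
    ∑ i, ‖(Bᴴ *ᵥ x) i‖ ^ 2 ≤ c * ∑ i, ‖x i‖ ^ 2 := by
  have h2 : star (Bᴴ *ᵥ x) ⬝ᵥ (Bᴴ *ᵥ x) = star x ⬝ᵥ (B *ᵥ (Bᴴ *ᵥ x)) := by
    rw [Matrix.star_mulVec, Matrix.conjTranspose_conjTranspose, ← Matrix.dotProduct_mulVec]
  have h3 := re_star_dotProduct_sq_le x (B *ᵥ (Bᴴ *ᵥ x))
  rw [← h2, re_star_dotProduct_self] at h3
  have h4 := h (Bᴴ *ᵥ x)
  set a := ∑ i, ‖x i‖ ^ 2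
  set e := ∑ i, ‖(Bᴴ *ᵥ x) i‖ ^ 2
  have ha : 0 ≤ a := by positivity
  have he : 0 ≤ e := by positivity
  rcases he.eq_or_lt with h0 | h0
  · rw [← h0]; positivity
  · have : e * e ≤ c * a * e := by
      calc e * e = e ^ 2 := by ring
        _ ≤ _ := h3
        _ ≤ a * (c * e) := by gcongr
        _ = _ := by ring
    exact le_of_mul_le_mul_right this h0

end Adjoint

/-! ### Stability, and the companion model -/

section Stable

variable {n : Type*} [Fintype n] [DecidableEq n] {d : ℕ} {A : Fin d → Matrix n n ℝ}

lemma muMax_pos [Nonempty n] (hA : IsStable A) : 0 < muMax A := by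
  have h1 := muMin_mul_le A 1 (fun _ => 1)
  have h2 := le_muMax_mul A 1 (fun _ => 1)
  have h3 : 0 < ∑ _i : n, ‖(1 : ℂ)‖ ^ 2 := by simp [Fintype.card_pos]
  exact pos_of_mul_pos_left ((mul_pos (muMin_pos hA) h3).trans_le (h1.trans h2)) h3.le

lemma muMin_mul_le_conjTranspose [Nonempty n] (hA : IsStable A) (z : Circle) (x : n → ℂ) :
    muMin A * ∑ i, ‖x i‖ ^ 2 ≤ ∑ i, ‖((revCharPoly A (z : ℂ))ᴴ *ᵥ x) i‖ ^ 2 :=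
  mul_le_conjTranspose_mulVec (hA z z.norm_coe) (muMin_pos hA) (muMin_mul_le A z) x

lemma conjTranspose_le_muMax_mul [Nonempty n] (hA : IsStable A) (z : Circle) (x : n → ℂ) :
    ∑ i, ‖((revCharPoly A (z : ℂ))ᴴ *ᵥ x) i‖ ^ 2 ≤ muMax A * ∑ i, ‖x i‖ ^ 2 :=
  conjTranspose_mulVec_le_mul (muMax_pos hA).le (le_muMax_mul A z) x

end Stable

/-- The companion VAR(1) model of a stable VAR(`d`) model is stable. -/
lemma IsStable.companionVAR {p d : ℕ} (hd : 1 ≤ d) {A : Fin d → Matrix (Fin p) (Fin p) ℝ}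
    (hA : IsStable A) : IsStable (companionVAR A) := by
  intro z hz hdet
  obtain ⟨x, hx0, hx⟩ := Matrix.exists_mulVec_eq_zero_iff.2 hdet
  have hrow : ∀ a, x a = z * ∑ b, (companion A a b : ℂ) * x b := by
    intro a
    have := congrFun hx a
    simp only [revCharPoly, SparseVAR.companionVAR, Finset.univ_unique, Finset.sum_singleton,
      Fin.default_eq_zero, Fin.val_zero, zero_add, pow_one, Matrix.sub_mulVec, Matrix.one_mulVec,
      Matrix.smul_mulVec, Pi.sub_apply, Pi.smul_apply, Pi.zero_apply, sub_eq_zero] at this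
    rw [this]
    simp [Matrix.mulVec, dotProduct]
  set y : Fin p → ℂ := fun i => x (⟨0, hd⟩, i) with hy
  -- The identity blocks force a kernel vector into the form (y, zy, …, z^(d-1)y); the first block
  -- row then reads 𝒜(z)y = 0.
  have hstep : ∀ h (hh : h < d), ∀ i, x (⟨h, hh⟩, i) = z ^ h * y i := by
    intro h
    induction h with
    | zero => intro hh i; simp [hy]
    | succ h ih =>
      intro hh i
      rw [hrow, Finset.sum_eq_single (⟨h, by omega⟩, i)]
      · rw [ih (by omega)]
        simp [companion, pow_succ]
        ring
      · rintro ⟨b, j⟩ - hb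
        have : ¬ ((h = (b : ℕ)) ∧ i = j) := by
          rintro ⟨rfl, rfl⟩; exact hb rfl
        simp [companion, this]
      · simp
  have hker : revCharPoly A z *ᵥ y = 0 := by
    ext i
    have h0 := hrow (⟨0, hd⟩, i)
    rw [Fintype.sum_prod_type] at h0
    simp only [revCharPoly, Matrix.sub_mulVec, Matrix.one_mulVec, Pi.sub_apply, Pi.zero_apply,
      sub_eq_zero, Matrix.sum_mulVec, Finset.sum_apply, Matrix.smul_mulVec, Pi.smul_apply]
    change x _ = _
    rw [h0, Finset.mul_sum]
    refine Finset.sum_congr rfl fun b _ => ?_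
    simp only [Matrix.mulVec, dotProduct, smul_eq_mul, Finset.mul_sum, Matrix.map_apply]
    refine Finset.sum_congr rfl fun j _ => ?_
    rw [show x (b, j) = z ^ (b : ℕ) * y j from hstep b b.2 j]
    simp [companion]
    ring
  apply hA z hz
  rw [← Matrix.exists_mulVec_eq_zero_iff]
  refine ⟨y, fun hy0 => hx0 ?_, hker⟩
  ext ⟨b, j⟩
  rw [show x (b, j) = z ^ (b : ℕ) * y j from hstep b b.2 j, hy0]
  simp

/-! ### Periodic sequences and the discrete Fourier transform -/

section Cyclic

variable {M : ℕ} [NeZero M]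

/-- Parseval's identity on `ZMod M`. -/
lemma sum_norm_sq_sum_stdAddChar_mul (f : ZMod M → ℂ) :
    ∑ k : ZMod M, ‖∑ t, ZMod.stdAddChar (k * t) * f t‖ ^ 2 = M * ∑ t, ‖f t‖ ^ 2 := by
  have key : ∀ k : ZMod M, ((‖∑ t, ZMod.stdAddChar (k * t) * f t‖ ^ 2 : ℝ) : ℂ) =
      ∑ t, ∑ s, f t * (starRingEnd ℂ) (f s) * ZMod.stdAddChar (k * (t - s)) := by
    intro k
    push_cast
    rw [← Complex.mul_conj', map_sum, Finset.sum_mul_sum]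
    refine Finset.sum_congr rfl fun t _ => Finset.sum_congr rfl fun s _ => ?_
    rw [map_mul (starRingEnd ℂ), ← AddChar.map_neg_eq_conj, mul_sub, sub_eq_add_neg, AddChar.map_add_eq_mul]
    ring
  have h : ((∑ k : ZMod M, ‖∑ t, ZMod.stdAddChar (k * t) * f t‖ ^ 2 : ℝ) : ℂ) =
      ((M * ∑ t, ‖f t‖ ^ 2 : ℝ) : ℂ) := by
    rw [Complex.ofReal_sum]
    simp_rw [key]
    rw [Finset.sum_comm]
    simp_rw [Finset.sum_comm (s := Finset.univ (α := ZMod M)) (t := Finset.univ (α := ZMod M))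
      (f := fun k s => _ * (starRingEnd ℂ) (f s) * _), ← Finset.mul_sum,
      AddChar.sum_mulShift _ (ZMod.isPrimitive_stdAddChar M), sub_eq_zero]
    push_cast
    simp only [ZMod.card, mul_ite, mul_zero, Finset.sum_ite_eq, Finset.mem_univ, if_true,
      Finset.mul_sum]
    refine Finset.sum_congr rfl fun t _ => ?_
    rw [Complex.mul_conj']
    ring
  exact_mod_cast h

variable {n : Type*} [Fintype n] [DecidableEq n] {d : ℕ}

/-- The adjoint of the lag polynomial, acting on `M`-periodic sequences. -/
def cyclicAdjoint (M : ℕ) (A : Fin d → Matrix n n ℝ) :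
    (ZMod M → n → ℝ) →ₗ[ℝ] (ZMod M → n → ℝ) where
  toFun g t := g t - ∑ h : Fin d, (A h)ᵀ *ᵥ g (t + ((h : ℕ) + 1 : ℕ))
  map_add' g g' := by
    ext t i
    simp only [Pi.add_apply, Pi.sub_apply, Matrix.mulVec_add, Finset.sum_add_distrib]
    ring
  map_smul' c g := by
    ext t i
    simp only [Pi.smul_apply, Pi.sub_apply, Matrix.mulVec_smul, ← Finset.smul_sum, smul_eq_mul,
      RingHom.id_apply]
    ring

/-- With z the root of unity at frequency k, a forward shift by h becomes multiplication by the
conjugate of z^h. The coefficients are real and transposed, so the symbol is exactly 𝒜(z)ᴴ. -/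
lemma sum_stdAddChar_mul_cyclicAdjoint (A : Fin d → Matrix n n ℝ) (g : ZMod M → n → ℝ)
    (k : ZMod M) (i : n) :
    ∑ t, ZMod.stdAddChar (k * t) * (cyclicAdjoint M A g t i : ℂ) =
      ((revCharPoly A (ZMod.toCircle k : ℂ))ᴴ *ᵥ
        fun j => ∑ t, ZMod.stdAddChar (k * t) * (g t j : ℂ)) i := by
  have hz : ∀ h : ℕ, star ((ZMod.toCircle k : ℂ) ^ h) = ZMod.stdAddChar (-(k * (h : ZMod M))) := by
    intro h
    rw [AddChar.map_neg_eq_conj, mul_comm, ← nsmul_eq_mul, AddChar.map_nsmul_eq_pow]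
    rfl
  have hshift : ∀ (h : ℕ) (j : n), ∑ t, ZMod.stdAddChar (k * t) * (g (t + h) j : ℂ) =
      star ((ZMod.toCircle k : ℂ) ^ h) * ∑ t, ZMod.stdAddChar (k * t) * (g t j : ℂ) := by
    intro h j
    rw [hz, Finset.mul_sum, ← Equiv.sum_comp (Equiv.addRight (h : ZMod M))
      (fun t => ZMod.stdAddChar (-(k * (h : ZMod M))) * (ZMod.stdAddChar (k * t) * (g t j : ℂ)))]
    refine Finset.sum_congr rfl fun t _ => ?_
    rw [← mul_assoc, ← AddChar.map_add_eq_mul]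
    simp only [Equiv.coe_addRight]
    congr 2
    ring
  simp only [revCharPoly, Matrix.conjTranspose_sub, Matrix.conjTranspose_one, Matrix.sub_mulVec,
    Matrix.one_mulVec, Pi.sub_apply, Matrix.conjTranspose_sum, Matrix.conjTranspose_smul,
    Matrix.sum_mulVec, Finset.sum_apply, Matrix.smul_mulVec, Pi.smul_apply, cyclicAdjoint,
    LinearMap.coe_mk, AddHom.coe_mk, Complex.ofReal_sub, Complex.ofReal_sum, mul_sub,
    Finset.sum_sub_distrib, Finset.mul_sum]
  congr 1
  rw [Finset.sum_comm]
  refine Finset.sum_congr rfl fun h _ => ?_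
  simp only [Matrix.mulVec, dotProduct, smul_eq_mul, Complex.ofReal_sum, Complex.ofReal_mul,
    Matrix.transpose_apply, Matrix.conjTranspose_apply, Matrix.map_apply]
  rw [Finset.mul_sum]
  simp_rw [Finset.mul_sum]
  rw [Finset.sum_comm]
  refine Finset.sum_congr rfl fun j _ => ?_
  have := hshift (h + 1) j
  calc _ = (A h j i : ℂ) * ∑ t, ZMod.stdAddChar (k * t) * (g (t + ((h + 1 : ℕ) : ZMod M)) j : ℂ) := by
        rw [Finset.mul_sum]
        exact Finset.sum_congr rfl fun t _ => by ring
    _ = _ := by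
        rw [this, Finset.mul_sum, Finset.mul_sum]
        refine Finset.sum_congr rfl fun t _ => ?_
        simp
        ring

lemma card_mul_sum_sq_eq (g : ZMod M → n → ℝ) :
    M * ∑ t, ∑ i, g t i ^ 2 =
      ∑ k : ZMod M, ∑ i, ‖∑ t, ZMod.stdAddChar (k * t) * (g t i : ℂ)‖ ^ 2 := by
  rw [Finset.sum_comm, Finset.mul_sum]
  conv_rhs => rw [Finset.sum_comm]
  refine Finset.sum_congr rfl fun i _ => ?_
  rw [sum_norm_sq_sum_stdAddChar_mul]
  simp

/-- Parseval reduces the claim to one frequency at a time. Only points of the unit circle occur, so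
the constant does not depend on M. -/
lemma muMin_mul_le_cyclicAdjoint [Nonempty n] {A : Fin d → Matrix n n ℝ} (hA : IsStable A)
    (g : ZMod M → n → ℝ) :
    muMin A * ∑ t, ∑ i, g t i ^ 2 ≤ ∑ t, ∑ i, cyclicAdjoint M A g t i ^ 2 := by
  have hM : (0 : ℝ) < M := by exact_mod_cast Nat.pos_of_ne_zero (NeZero.ne M)
  refine le_of_mul_le_mul_left ?_ hM
  rw [mul_left_comm, card_mul_sum_sq_eq, card_mul_sum_sq_eq, Finset.mul_sum]
  refine Finset.sum_le_sum fun k _ => ?_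
  simp_rw [sum_stdAddChar_mul_cyclicAdjoint]
  exact muMin_mul_le_conjTranspose hA _ _

lemma cyclicAdjoint_le_muMax_mul [Nonempty n] {A : Fin d → Matrix n n ℝ} (hA : IsStable A)
    (g : ZMod M → n → ℝ) :
    ∑ t, ∑ i, cyclicAdjoint M A g t i ^ 2 ≤ muMax A * ∑ t, ∑ i, g t i ^ 2 := by
  have hM : (0 : ℝ) < M := by exact_mod_cast Nat.pos_of_ne_zero (NeZero.ne M)
  refine le_of_mul_le_mul_left ?_ hM
  rw [mul_left_comm, card_mul_sum_sq_eq, card_mul_sum_sq_eq, Finset.mul_sum]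
  refine Finset.sum_le_sum fun k _ => ?_
  simp_rw [sum_stdAddChar_mul_cyclicAdjoint]
  exact conjTranspose_le_muMax_mul hA _ _

/-- The lower bound gives injectivity, and the space of periodic sequences is finite-dimensional. -/
lemma cyclicAdjoint_surjective [Nonempty n] {A : Fin d → Matrix n n ℝ} (hA : IsStable A) :
    Function.Surjective (cyclicAdjoint M A) := by
  rw [← LinearMap.injective_iff_surjective, ← LinearMap.ker_eq_bot, LinearMap.ker_eq_bot']
  intro g hg
  have h := muMin_mul_le_cyclicAdjoint hA g
  rw [hg] at h
  simp only [Pi.zero_apply, ne_eq, OfNat.ofNat_ne_zero, not_false_eq_true, zero_pow,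
    Finset.sum_const_zero] at h
  have h2 : ∑ t, ∑ i, g t i ^ 2 ≤ 0 := by
    by_contra! h'
    exact absurd h (not_le.2 (mul_pos (muMin_pos hA) h'))
  ext t i
  have h3 : g t i ^ 2 ≤ ∑ t, ∑ i, g t i ^ 2 :=
    (Finset.single_le_sum (f := fun i => g t i ^ 2) (fun i _ => sq_nonneg _)
      (Finset.mem_univ i)).trans
    (Finset.single_le_sum (f := fun t => ∑ i, g t i ^ 2) (fun t _ => by positivity)
      (Finset.mem_univ t))
  exact pow_eq_zero_iff two_ne_zero |>.1 (le_antisymm (h3.trans h2) (sq_nonneg _))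

end Cyclic

/-! ### Cutting the cycle open: solutions that are small at both ends -/

section Cut

variable {n : Type*} [Fintype n] [DecidableEq n] {d : ℕ}

/-- The adjoint of the lag polynomial, acting on two-sided sequences. -/
def lagAdjoint (A : Fin d → Matrix n n ℝ) (g : ℤ → n → ℝ) (t : ℤ) : n → ℝ :=
  g t - ∑ h : Fin d, (A h)ᵀ *ᵥ g (t + ((h : ℕ) + 1 : ℕ))

lemma sum_range_sub_shift (F : ℕ → ℝ) (M k : ℕ) :
    ∑ j ∈ Finset.range M, F j - ∑ j ∈ Finset.range M, F (k + j) =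
      ∑ j ∈ Finset.range k, (F j - F (M + j)) := by
  have h1 := Finset.sum_range_add F M k
  have h2 := Finset.sum_range_add F k M
  rw [add_comm k M] at h2
  rw [Finset.sum_sub_distrib]
  linarith

/-- Summation by parts over a window of length `M`: pairing a solution of the autoregressive
equation with `lagAdjoint A g` amounts to pairing the noise with `g`, up to boundary terms. -/
lemma sum_lagAdjoint_dotProduct (A : Fin d → Matrix n n ℝ) (x e : ℤ → n → ℝ)
    (hx : ∀ t, x t = ∑ h : Fin d, A h *ᵥ x (t - ((h : ℕ) + 1 : ℕ)) + e t) (g : ℤ → n → ℝ)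
    (c : ℤ) (M : ℕ) :
    ∑ k ∈ Finset.range M, lagAdjoint A g (c + k) ⬝ᵥ x (c + k) =
      ∑ k ∈ Finset.range M, g (c + k) ⬝ᵥ e (c + k) +
        ∑ h : Fin d, ∑ k ∈ Finset.range ((h : ℕ) + 1),
          (g (c + k) ⬝ᵥ (A h *ᵥ x (c + k - ((h : ℕ) + 1 : ℕ))) -
            g (c + (M + k : ℕ)) ⬝ᵥ (A h *ᵥ x (c + (M + k : ℕ) - ((h : ℕ) + 1 : ℕ)))) := by
  have h1 : ∀ t, lagAdjoint A g t ⬝ᵥ x t =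
      g t ⬝ᵥ x t - ∑ h : Fin d, g (t + ((h : ℕ) + 1 : ℕ)) ⬝ᵥ (A h *ᵥ x t) := by
    intro t
    rw [lagAdjoint, sub_dotProduct, sum_dotProduct]
    congr 1
    refine Finset.sum_congr rfl fun h _ => ?_
    rw [Matrix.dotProduct_mulVec, Matrix.mulVec_transpose]
  have h2 : ∀ t, g t ⬝ᵥ x t =
      g t ⬝ᵥ e t + ∑ h : Fin d, g t ⬝ᵥ (A h *ᵥ x (t - ((h : ℕ) + 1 : ℕ))) := by
    intro t
    conv_lhs => rw [hx t]
    rw [dotProduct_add, dotProduct_sum, add_comm]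
  simp_rw [h1, h2]
  rw [Finset.sum_sub_distrib, Finset.sum_add_distrib, add_sub_assoc,
    Finset.sum_comm, Finset.sum_comm (s := Finset.range M), ← Finset.sum_sub_distrib]
  congr 1
  refine Finset.sum_congr rfl fun h _ => ?_
  rw [← sum_range_sub_shift
    (fun k : ℕ => g (c + k) ⬝ᵥ (A h *ᵥ x (c + k - ((h : ℕ) + 1 : ℕ)))) M ((h : ℕ) + 1)]
  congr 1
  refine Finset.sum_congr rfl fun k _ => ?_
  have e1 : c + k + ((h : ℕ) + 1 : ℕ) = c + ((h : ℕ) + 1 + k : ℕ) := by push_cast; ring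
  have e2 : c + ((h : ℕ) + 1 + k : ℕ) - ((h : ℕ) + 1 : ℕ) = c + k := by push_cast; ring
  simp only [e1, e2]

lemma sum_zmod_eq_sum_window {M : ℕ} [NeZero M] (f : ZMod M → ℝ) (c : ℤ) :
    ∑ t, f t = ∑ k ∈ Finset.range M, f ((c + k : ℤ) : ZMod M) := by
  rw [← Equiv.sum_comp (Equiv.addLeft (c : ZMod M)) f]
  refine Finset.sum_nbij' (fun t => t.val) (fun k => (k : ZMod M)) ?_ ?_ ?_ ?_ ?_
  · intro t _; exact Finset.mem_range.2 (ZMod.val_lt t)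
  · intro k _; exact Finset.mem_univ _
  · intro t _; exact ZMod.natCast_zmod_val t
  · intro k hk; exact ZMod.val_cast_of_lt (Finset.mem_range.1 hk)
  · intro t _
    simp

/-- The m blocks of length d just before time 0 tile one interval; these are the candidate places
for the cut. -/
lemma sum_blocks (F : ℤ → ℝ) (d m : ℕ) :
    ∑ j ∈ Finset.range m, ∑ k ∈ Finset.range d, F (-((j + 1 : ℕ) * d : ℤ) + k) =
      ∑ k ∈ Finset.range (m * d), F (-(m * d : ℤ) + k) := by
  induction m with
  | zero => simp
  | succ m ih =>
    rw [Finset.sum_range_succ, ih, add_mul, one_mul, add_comm (m * d) d, Finset.sum_range_add,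
      add_comm]
    congr 1
    refine Finset.sum_congr rfl fun k _ => ?_
    congr 1
    push_cast
    ring

/-- A finitely supported right-hand side has, on some long window around its support, a preimage
under `lagAdjoint` that obeys the norm bounds of `cyclicAdjoint` and is small at both ends. -/
lemma exists_lagAdjoint_eq [Nonempty n] {A : Fin d → Matrix n n ℝ} (hA : IsStable A) (T : ℕ)
    (w : ℤ → n → ℝ) (hw : ∀ t, t < 0 ∨ (T : ℤ) ≤ t → w t = 0) (hT : 0 < T) (m : ℕ) (hm : 0 < m) :
    ∃ (g : ℤ → n → ℝ) (c : ℤ) (M : ℕ),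
      (∀ k < M, lagAdjoint A g (c + k) = w (c + k)) ∧
      (∀ f : ℤ → ℝ, (∀ t, t < 0 ∨ (T : ℤ) ≤ t → f t = 0) →
        ∑ k ∈ Finset.range M, f (c + k) = ∑ k ∈ Finset.range T, f k) ∧
      muMin A * ∑ k ∈ Finset.range M, ∑ i, g (c + k) i ^ 2 ≤
        ∑ k ∈ Finset.range T, ∑ i, w k i ^ 2 ∧
      ∑ k ∈ Finset.range T, ∑ i, w k i ^ 2 ≤
        muMax A * ∑ k ∈ Finset.range M, ∑ i, g (c + k) i ^ 2 ∧
      ∀ k < d, ∀ i, |g (c + k) i| ≤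
          √((∑ k ∈ Finset.range T, ∑ i, w k i ^ 2) / muMin A / m) ∧
        |g (c + (M + k : ℕ)) i| ≤
          √((∑ k ∈ Finset.range T, ∑ i, w k i ^ 2) / muMin A / m) := by
  -- One period holds the support of w and m spare blocks of length d.
  set M := m * d + T with hM
  have : NeZero M := ⟨by omega⟩
  set W := ∑ k ∈ Finset.range T, ∑ i, w k i ^ 2 with hW
  have hμ := muMin_pos hA
  obtain ⟨g, hg⟩ := cyclicAdjoint_surjective (M := M) hA (fun t => w (t.val : ℤ))
  have hsum : ∀ j ≤ m, ∀ f : ℤ → ℝ, (∀ t, t < 0 ∨ (T : ℤ) ≤ t → f t = 0) →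
      ∑ k ∈ Finset.range M, f (-(j * d : ℤ) + k) = ∑ k ∈ Finset.range T, f k := by
    intro j hj f hf
    obtain ⟨r, hr⟩ := Nat.exists_eq_add_of_le hj
    rw [show M = j * d + (T + r * d) by rw [hM, hr]; ring, Finset.sum_range_add,
      Finset.sum_range_add]
    have e1 : ∑ k ∈ Finset.range (j * d), f (-(j * d : ℤ) + k) = 0 :=
      Finset.sum_eq_zero fun k hk => hf _ (Or.inl (by
        have := Finset.mem_range.1 hk; zify at this; linarith))
    have e2 : ∑ k ∈ Finset.range (r * d), f (-(j * d : ℤ) + (j * d + (T + k) : ℕ)) = 0 :=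
      Finset.sum_eq_zero fun k hk => hf _ (Or.inr (by push_cast; linarith [Int.natCast_nonneg k]))
    rw [e1, e2, zero_add, add_zero]
    refine Finset.sum_congr rfl fun k _ => ?_
    congr 1
    push_cast
    ring
  have hwsum : ∑ t : ZMod M, ∑ i, cyclicAdjoint M A g t i ^ 2 = W := by
    rw [hg, sum_zmod_eq_sum_window _ 0, hW,
      ← hsum 0 (Nat.zero_le _) (fun t => ∑ i, w t i ^ 2) (fun t ht => by simp [hw t ht])]
    refine Finset.sum_congr rfl fun k hk => ?_
    have : ((((0 : ℤ) + k : ℤ) : ZMod M)).val = k := by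
      rw [zero_add, Int.cast_natCast, ZMod.val_cast_of_lt (Finset.mem_range.1 hk)]
    simp only [this]
    simp
  have hlow := muMin_mul_le_cyclicAdjoint hA g
  have hupp := cyclicAdjoint_le_muMax_mul hA g
  rw [hwsum] at hlow hupp
  -- Pigeonhole: the m disjoint blocks share total mass at most W / μ_min, so one of them carries at
  -- most a fraction 1/m of it.
  obtain ⟨j, hj, hjle⟩ : ∃ j ∈ Finset.range m,
      ∑ k ∈ Finset.range d, ∑ i, g ((-((j + 1 : ℕ) * d : ℤ) + k : ℤ) : ZMod M) i ^ 2 ≤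
        W / muMin A / m := by
    refine Finset.exists_le_of_sum_le ⟨0, Finset.mem_range.2 hm⟩ ?_
    rw [sum_blocks (fun t => ∑ i, g (t : ZMod M) i ^ 2) d m, Finset.sum_const, Finset.card_range,
      nsmul_eq_mul, mul_div_cancel₀ _ (by positivity : (m : ℝ) ≠ 0), le_div_iff₀' hμ]
    refine le_trans ?_ hlow
    rw [sum_zmod_eq_sum_window _ (-(m * d : ℤ))]
    refine mul_le_mul_of_nonneg_left ?_ hμ.le
    exact Finset.sum_le_sum_of_subset_of_nonneg (Finset.range_mono (by omega))
      fun _ _ _ => by positivity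
  have hjm : j + 1 ≤ m := Finset.mem_range.1 hj
  have hend : ∀ k < d, ∀ i, |g ((-((j + 1 : ℕ) * d : ℤ) + k : ℤ) : ZMod M) i| ≤
      √(W / muMin A / m) := by
    intro k hk i
    refine Real.abs_le_sqrt (le_trans ?_ hjle)
    refine le_trans ?_ (Finset.single_le_sum
      (f := fun k : ℕ => ∑ i, g ((-((j + 1 : ℕ) * d : ℤ) + k : ℤ) : ZMod M) i ^ 2)
      (fun _ _ => by positivity) (Finset.mem_range.2 hk))
    exact Finset.single_le_sum
      (f := fun i => g ((-((j + 1 : ℕ) * d : ℤ) + k : ℤ) : ZMod M) i ^ 2)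
      (fun _ _ => sq_nonneg _) (Finset.mem_univ i)
  -- The window starts with the light block. By periodicity the d times just after the window carry
  -- the same values, so both ends are small.
  refine ⟨fun t => g (t : ZMod M), -((j + 1 : ℕ) * d : ℤ), M, ?_, hsum (j + 1) hjm, ?_, ?_, ?_⟩
  · intro k hk
    set a : ℤ := -((j + 1 : ℕ) * d : ℤ) + k with ha
    have h1 : lagAdjoint A (fun t => g (t : ZMod M)) a = cyclicAdjoint M A g (a : ZMod M) := by
      simp [lagAdjoint, cyclicAdjoint]
    rw [h1, hg]
    have hjd : ((j + 1 : ℕ) * d : ℤ) ≤ m * d := by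
      exact_mod_cast Nat.mul_le_mul_right d hjm
    have hMz : (M : ℤ) = m * d + T := by rw [hM]; push_cast; ring
    have hkz : (k : ℤ) < M := by exact_mod_cast hk
    have hjd0 : (0 : ℤ) ≤ ((j + 1 : ℕ) * d : ℤ) := by positivity
    change w (((a : ZMod M).val : ℕ) : ℤ) = w a
    rw [ZMod.val_intCast]
    -- The representative of `a` in [0, M) is `a` itself, or `a + M ≥ T` when `a` is negative; in
    -- the latter case both values of `w` vanish.
    rcases le_or_gt 0 a with h0 | h0
    · rw [Int.emod_eq_of_lt h0 (by linarith)]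
    · rw [← Int.add_mul_emod_self_left a M 1, mul_one,
        Int.emod_eq_of_lt (by have := Int.natCast_nonneg k; linarith) (by linarith),
        hw a (Or.inl h0), hw _ (Or.inr (by have := Int.natCast_nonneg k; linarith))]
  · rw [← sum_zmod_eq_sum_window (fun t => ∑ i, g t i ^ 2)]
    exact hlow
  · rw [← sum_zmod_eq_sum_window (fun t => ∑ i, g t i ^ 2)]
    exact hupp
  · intro k hk i
    refine ⟨hend k hk i, ?_⟩
    have := hend k hk i
    push_cast at this ⊢
    simpa [add_comm, add_left_comm] using this

end Cut

/-! ### Gaussian laws as limits of characteristic functions -/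

section GaussianLimit

variable {Ω : Type*} [MeasurableSpace Ω] {P : Measure Ω} [IsProbabilityMeasure P]

/-- A variable whose characteristic function is a limit of centred Gaussian ones with bounded
variances is centred Gaussian. -/
lemma exists_map_eq_gaussianReal {Y : Ω → ℝ} (hY : AEMeasurable Y P) {lo hi : ℝ} (hlo : 0 ≤ lo)
    {δ : ℕ → ℝ} (hδ : Filter.Tendsto δ Filter.atTop (nhds 0))
    (h : ∀ m, ∃ V ∈ Set.Icc lo hi, ∀ ξ : ℝ,
      ‖charFun (P.map Y) ξ - Complex.exp (((-(V * ξ ^ 2 / 2) : ℝ) : ℂ))‖ ≤ |ξ| * δ m) :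
    ∃ V ∈ Set.Icc lo hi, P.map Y = gaussianReal 0 V.toNNReal := by
  choose V hV hVξ using h
  -- The approximating variances need not converge; a cluster point in the compact interval is
  -- enough.
  obtain ⟨V₀, hV₀, φ, hφ, hlim⟩ := isCompact_Icc.tendsto_subseq hV
  refine ⟨V₀, hV₀, ?_⟩
  have : IsProbabilityMeasure (P.map Y) := Measure.isProbabilityMeasure_map hY
  refine Measure.ext_of_charFun (funext fun ξ => ?_)
  have h1 : Filter.Tendsto (fun m => Complex.exp (((-(V (φ m) * ξ ^ 2 / 2) : ℝ) : ℂ)))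
      Filter.atTop (nhds (charFun (P.map Y) ξ)) := by
    rw [tendsto_iff_norm_sub_tendsto_zero]
    refine squeeze_zero (fun _ => norm_nonneg _) (fun m => ?_)
      (by simpa using (hδ.comp hφ.tendsto_atTop).const_mul |ξ|)
    rw [norm_sub_rev]
    exact hVξ (φ m) ξ
  have h2 : Filter.Tendsto (fun m => Complex.exp (((-(V (φ m) * ξ ^ 2 / 2) : ℝ) : ℂ)))
      Filter.atTop (nhds (Complex.exp (((-(V₀ * ξ ^ 2 / 2) : ℝ) : ℂ)))) := by
    have hc : Continuous fun v : ℝ => Complex.exp (((-(v * ξ ^ 2 / 2) : ℝ) : ℂ)) := by fun_prop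
    exact (hc.tendsto V₀).comp hlim
  rw [tendsto_nhds_unique h1 h2, charFun_gaussianReal]
  congr 1
  simp [Real.coe_toNNReal _ (hlo.trans hV₀.1)]

/-- From |exp(ia) - 1| ≤ |a|. A remainder that is small in L¹ is thus negligible, however it depends
on the rest. -/
lemma norm_integral_cexp_sub_le {Y B : Ω → ℝ} (hY : AEStronglyMeasurable Y P)
    (hB : Integrable B P) (ξ : ℝ) :
    ‖∫ ω, Complex.exp (ξ * Y ω * Complex.I) ∂P -
        ∫ ω, Complex.exp (ξ * (Y ω - B ω : ℝ) * Complex.I) ∂P‖ ≤ |ξ| * ∫ ω, |B ω| ∂P := by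
  have hint : ∀ Z : Ω → ℝ, AEStronglyMeasurable Z P →
      Integrable (fun ω => Complex.exp (ξ * Z ω * Complex.I)) P := by
    intro Z hZ
    have hc : Continuous fun z : ℝ => Complex.exp (ξ * z * Complex.I) := by fun_prop
    refine Integrable.of_bound (hc.comp_aestronglyMeasurable hZ) 1 (.of_forall fun ω => ?_)
    rw [← Complex.ofReal_mul, Complex.norm_exp_ofReal_mul_I]
  have hYB : AEStronglyMeasurable (fun ω => Y ω - B ω) P := hY.sub hB.1
  rw [← integral_sub (hint _ hY) (hint _ hYB), ← integral_const_mul]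
  refine norm_integral_le_of_norm_le (hB.abs.const_mul _) (.of_forall fun ω => ?_)
  have h1 : Complex.exp (ξ * Y ω * Complex.I) - Complex.exp (ξ * (Y ω - B ω : ℝ) * Complex.I) =
      Complex.exp ((ξ * (Y ω - B ω) : ℝ) * Complex.I) *
        (Complex.exp (Complex.I * (ξ * B ω : ℝ)) - 1) := by
    rw [mul_sub, mul_one, ← Complex.exp_add]
    congr 2 <;> (push_cast; ring)
  rw [h1, norm_mul, Complex.norm_exp_ofReal_mul_I, one_mul, ← abs_mul]
  exact Real.norm_exp_I_mul_ofReal_sub_one_le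

end GaussianLimit

/-! ### Linear functionals of a stable Gaussian autoregression -/

section Autoregression

variable {Ω n : Type*} [MeasurableSpace Ω] [Fintype n] [DecidableEq n] {d : ℕ}

/-- An `L¹`-bounded solution of an autoregressive equation, whose noise is independent over time
and centred Gaussian with covariance form `q`. -/
structure IsGaussianAutoregression (A : Fin d → Matrix n n ℝ) (q : (n → ℝ) → ℝ)
    (X e : ℤ → Ω → n → ℝ) (P : Measure Ω) : Prop where
  integrable : ∀ t i, Integrable (fun ω => X t ω i) P
  bounded : ∃ C, ∀ t i, ∫ ω, |X t ω i| ∂P ≤ C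
  equation : ∀ t, ∀ᵐ ω ∂P, X t ω = ∑ h : Fin d, A h *ᵥ X (t - ((h : ℕ) + 1 : ℕ)) ω + e t ω
  charFun_noise : ∀ (g : ℤ → n → ℝ) (c : ℤ) (M : ℕ),
    ∫ ω, Complex.exp (((∑ k ∈ Finset.range M, g (c + k) ⬝ᵥ e (c + k) ω : ℝ) : ℂ) * Complex.I) ∂P =
      Complex.exp (((-((∑ k ∈ Finset.range M, q (g (c + k))) / 2) : ℝ) : ℂ))

variable {P : Measure Ω} [IsProbabilityMeasure P]

/-- Bounds one boundary term of the summation by parts: it is linear in the size δ of the weight at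
the cut. -/
lemma integral_abs_dotProduct_mulVec_le {Z : Ω → n → ℝ} (hZ : ∀ i, Integrable (fun ω => Z ω i) P)
    {C δ : ℝ} (hC : ∀ i, ∫ ω, |Z ω i| ∂P ≤ C) {u : n → ℝ} (hδ : 0 ≤ δ) (hu : ∀ i, |u i| ≤ δ)
    (B : Matrix n n ℝ) :
    Integrable (fun ω => u ⬝ᵥ (B *ᵥ Z ω)) P ∧
      ∫ ω, |u ⬝ᵥ (B *ᵥ Z ω)| ∂P ≤ δ * (C * ∑ i, ∑ j, |B i j|) := by
  have hint : Integrable (fun ω => u ⬝ᵥ (B *ᵥ Z ω)) P := by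
    simp only [dotProduct, Matrix.mulVec]
    exact integrable_finsetSum _ fun i _ =>
      (integrable_finsetSum _ fun j _ => (hZ j).const_mul _).const_mul _
  refine ⟨hint, ?_⟩
  calc ∫ ω, |u ⬝ᵥ (B *ᵥ Z ω)| ∂P ≤ ∫ ω, ∑ i, ∑ j, δ * (|B i j| * |Z ω j|) ∂P := by
        refine integral_mono hint.abs (integrable_finsetSum _ fun i _ =>
          integrable_finsetSum _ fun j _ => ((hZ j).abs.const_mul _).const_mul _) fun ω => ?_
        refine (Finset.abs_sum_le_sum_abs _ _).trans (Finset.sum_le_sum fun i _ => ?_)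
        rw [abs_mul, ← Finset.mul_sum]
        refine mul_le_mul (hu i) ?_ (abs_nonneg _) hδ
        exact (Finset.abs_sum_le_sum_abs _ _).trans (by simp [abs_mul])
    _ = ∑ i, ∑ j, δ * (|B i j| * ∫ ω, |Z ω j| ∂P) := by
        rw [integral_finsetSum _ fun i _ =>
          integrable_finsetSum _ fun j _ => ((hZ j).abs.const_mul _).const_mul _]
        refine Finset.sum_congr rfl fun i _ => ?_
        rw [integral_finsetSum _ fun j _ => ((hZ j).abs.const_mul _).const_mul _]
        simp_rw [integral_const_mul]
    _ ≤ ∑ i, ∑ j, δ * (|B i j| * C) := by gcongr with i _ j _; exact hC j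
    _ = _ := by
        simp_rw [← Finset.mul_sum, ← Finset.sum_mul]
        ring

/-- Linear functionals of a stable Gaussian autoregression are centred Gaussian, with a variance
that is controlled by the spectrum of the lag polynomial. -/
theorem IsGaussianAutoregression.exists_map_eq_gaussianReal [Nonempty n]
    {A : Fin d → Matrix n n ℝ} (hA : IsStable A) {q : (n → ℝ) → ℝ} {X e : ℤ → Ω → n → ℝ}
    (hX : IsGaussianAutoregression A q X e P) (hq : ∀ (ξ : ℝ) x, q (ξ • x) = ξ ^ 2 * q x)
    {smin smax : ℝ} (hs : 0 ≤ smin) (hlow : ∀ x, smin * ∑ i, x i ^ 2 ≤ q x)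
    (hupp : ∀ x, q x ≤ smax * ∑ i, x i ^ 2) (hs' : 0 ≤ smax)
    {T : ℕ} (hT : 0 < T) (w : ℤ → n → ℝ)
    (hw : ∀ t, t < 0 ∨ (T : ℤ) ≤ t → w t = 0) :
    ∃ V ∈ Set.Icc (smin * ((∑ k ∈ Finset.range T, ∑ i, w k i ^ 2) / muMax A))
        (smax * ((∑ k ∈ Finset.range T, ∑ i, w k i ^ 2) / muMin A)),
      P.map (fun ω => ∑ k ∈ Finset.range T, w k ⬝ᵥ X k ω) = gaussianReal 0 V.toNNReal := by
  set W := ∑ k ∈ Finset.range T, ∑ i, w k i ^ 2 with hW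
  have hW0 : 0 ≤ W := by positivity
  have hmin := muMin_pos hA
  have hmax := muMax_pos hA
  obtain ⟨C, hC⟩ := hX.bounded
  set D : ℝ := ∑ h : Fin d, ∑ _k ∈ Finset.range ((h : ℕ) + 1), 2 * (C * ∑ i, ∑ j, |A h i j|)
  have hYint : Integrable (fun ω => ∑ k ∈ Finset.range T, w k ⬝ᵥ X k ω) P :=
    integrable_finsetSum _ fun k _ => integrable_finsetSum _ fun i _ =>
      (hX.integrable k i).const_mul _
  refine SparseVAR.exists_map_eq_gaussianReal (δ := fun m => D * √(W / muMin A / (m + 1 : ℕ)))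
    hYint.1.aemeasurable (by positivity) ?_ fun m => ?_
  · have h0 : Filter.Tendsto (fun m : ℕ => W / muMin A / ((m + 1 : ℕ) : ℝ)) Filter.atTop (nhds 0) :=
      (tendsto_const_div_atTop_nhds_zero_nat _).comp (Filter.tendsto_add_atTop_nat 1)
    simpa using (h0.sqrt).const_mul D
  -- The number of spare blocks is `m + 1`, to keep it positive; the end values of `g` are then
  -- O((m+1)^(-1/2)).
  obtain ⟨g, c, M, hg, hsum, hg1, hg2, hend⟩ :=
    exists_lagAdjoint_eq hA T w hw hT (m + 1) m.succ_pos
  rw [← hW] at hg1 hg2 hend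
  set δ := √(W / muMin A / (m + 1 : ℕ))
  have hδ : 0 ≤ δ := Real.sqrt_nonneg _
  -- The variance of the noise functional ∑ g·e that replaces ∑ w·X.
  refine ⟨∑ k ∈ Finset.range M, q (g (c + k)), ⟨?_, ?_⟩, fun ξ => ?_⟩
  · calc smin * (W / muMax A) ≤ smin * ∑ k ∈ Finset.range M, ∑ i, g (c + k) i ^ 2 := by
          gcongr; rwa [div_le_iff₀' hmax]
      _ ≤ _ := by rw [Finset.mul_sum]; exact Finset.sum_le_sum fun k _ => hlow _
  · calc ∑ k ∈ Finset.range M, q (g (c + k))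
        ≤ smax * ∑ k ∈ Finset.range M, ∑ i, g (c + k) i ^ 2 := by
          rw [Finset.mul_sum]; exact Finset.sum_le_sum fun k _ => hupp _
      _ ≤ _ := by gcongr; rwa [le_div_iff₀' hmin]
  set Y : Ω → ℝ := fun ω => ∑ k ∈ Finset.range T, w k ⬝ᵥ X k ω with hY
  set R : Ω → ℝ := fun ω => ∑ h : Fin d, ∑ k ∈ Finset.range ((h : ℕ) + 1),
          (g (c + k) ⬝ᵥ (A h *ᵥ X (c + k - ((h : ℕ) + 1 : ℕ)) ω) -
            g (c + (M + k : ℕ)) ⬝ᵥ (A h *ᵥ X (c + (M + k : ℕ) - ((h : ℕ) + 1 : ℕ)) ω)) with hR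
  have hk : ∀ (h : Fin d), ∀ k ∈ Finset.range ((h : ℕ) + 1), k < d := by
    intro h k hk
    have := Finset.mem_range.1 hk
    omega
  have hterm1 : ∀ (h : Fin d), ∀ k ∈ Finset.range ((h : ℕ) + 1), _ := fun h k hk' =>
    integral_abs_dotProduct_mulVec_le (P := P) (hX.integrable (c + k - ((h : ℕ) + 1 : ℕ)))
      (hC _) hδ (fun i => (hend k (hk h k hk') i).1) (A h)
  have hterm2 : ∀ (h : Fin d), ∀ k ∈ Finset.range ((h : ℕ) + 1), _ := fun h k hk' =>
    integral_abs_dotProduct_mulVec_le (P := P)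
      (hX.integrable (c + (M + k : ℕ) - ((h : ℕ) + 1 : ℕ)))
      (hC _) hδ (fun i => (hend k (hk h k hk') i).2) (A h)
  have hadd : ∀ (h : Fin d), ∀ k ∈ Finset.range ((h : ℕ) + 1), Integrable (fun ω =>
      |g (c + k) ⬝ᵥ (A h *ᵥ X (c + k - ((h : ℕ) + 1 : ℕ)) ω)| +
        |g (c + (M + k : ℕ)) ⬝ᵥ (A h *ᵥ X (c + (M + k : ℕ) - ((h : ℕ) + 1 : ℕ)) ω)|) P :=
    fun h k hk' => (hterm1 h k hk').1.abs.add (hterm2 h k hk').1.abs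
  have hRint : Integrable R P := integrable_finsetSum _ fun h _ =>
    integrable_finsetSum _ fun k hk' => (hterm1 h k hk').1.sub (hterm2 h k hk').1
  have hRle : ∫ ω, |R ω| ∂P ≤ D * δ := by
    calc ∫ ω, |R ω| ∂P ≤ ∫ ω, ∑ h : Fin d, ∑ k ∈ Finset.range ((h : ℕ) + 1),
          (|g (c + k) ⬝ᵥ (A h *ᵥ X (c + k - ((h : ℕ) + 1 : ℕ)) ω)| +
            |g (c + (M + k : ℕ)) ⬝ᵥ (A h *ᵥ X (c + (M + k : ℕ) - ((h : ℕ) + 1 : ℕ)) ω)|) ∂P := by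
          refine integral_mono hRint.abs (integrable_finsetSum _ fun h _ =>
            integrable_finsetSum _ fun k hk' => hadd h k hk') fun ω => ?_
          refine (Finset.abs_sum_le_sum_abs _ _).trans (Finset.sum_le_sum fun h _ => ?_)
          refine (Finset.abs_sum_le_sum_abs _ _).trans (Finset.sum_le_sum fun k _ => ?_)
          exact abs_sub _ _
      _ ≤ ∑ h : Fin d, ∑ k ∈ Finset.range ((h : ℕ) + 1), 2 * (C * ∑ i, ∑ j, |A h i j|) * δ := by
          rw [integral_finsetSum _ fun h _ => integrable_finsetSum _ fun k hk' => hadd h k hk']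
          refine Finset.sum_le_sum fun h _ => ?_
          rw [integral_finsetSum _ fun k hk' => hadd h k hk']
          refine Finset.sum_le_sum fun k hk' => ?_
          rw [integral_add (hterm1 h k hk').1.abs (hterm2 h k hk').1.abs]
          linarith [(hterm1 h k hk').2, (hterm2 h k hk').2]
      _ = D * δ := by simp only [D, Finset.sum_mul]
  -- Summation by parts: up to the boundary terms `R`, pairing `X` with `w = lagAdjoint A g` is
  -- pairing the noise with `g`.
  have hae : ∀ᵐ ω ∂P, Y ω - R ω = ∑ k ∈ Finset.range M, g (c + k) ⬝ᵥ e (c + k) ω := by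
    filter_upwards [ae_all_iff.2 hX.equation] with ω hω
    have h1 := sum_lagAdjoint_dotProduct A (fun t => X t ω) (fun t => e t ω) hω g c M
    have h2 : ∑ k ∈ Finset.range M, lagAdjoint A g (c + k) ⬝ᵥ X (c + k) ω = Y ω := by
      rw [hY]
      dsimp only
      rw [← hsum (fun t => w t ⬝ᵥ X t ω) (fun t ht => by simp [hw t ht])]
      exact Finset.sum_congr rfl fun k hk' => by rw [hg k (Finset.mem_range.1 hk')]
    rw [h2] at h1
    rw [h1, hR]
    dsimp only
    ring
  have hchar : ∫ ω, Complex.exp (ξ * (Y ω - R ω : ℝ) * Complex.I) ∂P =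
      Complex.exp (((-((∑ k ∈ Finset.range M, q (g (c + k))) * ξ ^ 2 / 2) : ℝ) : ℂ)) := by
    have h1 := hX.charFun_noise (fun t => ξ • g t) c M
    simp only [smul_dotProduct, smul_eq_mul, ← Finset.mul_sum, hq] at h1
    rw [mul_comm (∑ k ∈ Finset.range M, q (g (c + k))), ← h1]
    refine integral_congr_ae ?_
    filter_upwards [hae] with ω hω
    rw [hω, Complex.ofReal_mul]
  rw [charFun_apply_real, integral_map hYint.1.aemeasurable (by fun_prop), ← hchar]
  exact (norm_integral_cexp_sub_le hYint.1 hRint ξ).trans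
    (mul_le_mul_of_nonneg_left hRle (abs_nonneg _))

end Autoregression

/-! ### VAR processes and their companion form as Gaussian autoregressions -/

section Stationary

variable {Ω : Type*} [MeasurableSpace Ω] {P : Measure Ω} [IsProbabilityMeasure P] {p d : ℕ}
  {A : Fin d → Matrix (Fin p) (Fin p) ℝ} {Sig : Matrix (Fin p) (Fin p) ℝ}
  {X ε : ℤ → Ω → EuclideanSpace ℝ (Fin p)}

lemma IsCovStationary.memLp_apply (hX : IsCovStationary X P) (t : ℤ) (i : Fin p) :
    MemLp (fun ω => X t ω i) 2 P :=
  (EuclideanSpace.proj (𝕜 := ℝ) i).comp_memLp' (hX.memLp t)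

lemma IsCovStationary.integral_sq_eq (hX : IsCovStationary X P) (t : ℤ) (i : Fin p) :
    ∫ ω, X t ω i ^ 2 ∂P = ∫ ω, X 0 ω i ^ 2 ∂P := by
  have hmean : ∀ t, ∫ ω, X t ω i ∂P = (∫ ω, X t ω ∂P) i := fun t =>
    (EuclideanSpace.proj (𝕜 := ℝ) i).integral_comp_comm ((hX.memLp t).integrable one_le_two)
  have h := hX.cov_eq t 0 0 i i
  rw [add_zero, add_zero, covariance_self (hX.memLp_apply t i).1.aemeasurable,
    covariance_self (hX.memLp_apply 0 i).1.aemeasurable, variance_eq_sub (hX.memLp_apply t i),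
    variance_eq_sub (hX.memLp_apply 0 i), hmean t, hmean 0, hX.mean_eq t 0] at h
  exact sub_left_injective h

lemma IsCovStationary.integral_abs_le (hX : IsCovStationary X P) (t : ℤ) (i : Fin p) :
    ∫ ω, |X t ω i| ∂P ≤ ∑ j, (1 + ∫ ω, X 0 ω j ^ 2 ∂P) := by
  have h1 : ∫ ω, |X t ω i| ∂P ≤ 1 + ∫ ω, X 0 ω i ^ 2 ∂P := by
    rw [← hX.integral_sq_eq t i]
    have hsq := (hX.memLp_apply t i).integrable_sq
    calc ∫ ω, |X t ω i| ∂P ≤ ∫ ω, (1 + X t ω i ^ 2) ∂P :=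
          integral_mono ((hX.memLp_apply t i).integrable one_le_two).abs
            ((integrable_const 1).add hsq) fun ω => by
              have h := sq_nonneg (|X t ω i| - 1)
              have h' := sq_abs (X t ω i)
              have h'' := abs_nonneg (X t ω i)
              simp only
              nlinarith
      _ = _ := by rw [integral_add (integrable_const 1) hsq]; simp
  exact h1.trans (Finset.single_le_sum (f := fun j => 1 + ∫ ω, X 0 ω j ^ 2 ∂P)
    (fun j _ => add_nonneg zero_le_one (integral_nonneg fun ω => sq_nonneg _)) (Finset.mem_univ i))

lemma IsVARProcess.charFun_noise (hX : IsVARProcess A Sig X ε P) (hSig : Sig.PosSemidef)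
    (g : ℤ → Fin p → ℝ) (c : ℤ) (M : ℕ) :
    ∫ ω, Complex.exp (((∑ k ∈ Finset.range M, g (c + k) ⬝ᵥ (ε (c + k) ω).ofLp : ℝ) : ℂ) *
        Complex.I) ∂P =
      Complex.exp (((-((∑ k ∈ Finset.range M, g (c + k) ⬝ᵥ (Sig *ᵥ g (c + k))) / 2) : ℝ) : ℂ)) := by
  have hone : ∀ (t : ℤ) (x : Fin p → ℝ),
      ∫ ω, Complex.exp (((x ⬝ᵥ (ε t ω).ofLp : ℝ) : ℂ) * Complex.I) ∂P =
        Complex.exp (((-((x ⬝ᵥ (Sig *ᵥ x)) / 2) : ℝ) : ℂ)) := by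
    intro t x
    have h := charFun_multivariateGaussian (μ := 0) hSig (WithLp.toLp 2 x)
    rw [← (hX.innovation_law t).map_eq, charFun_apply,
      integral_map (hX.innovation_law t).aemeasurable (by fun_prop)] at h
    simp only [inner_zero_right, Complex.ofReal_zero, zero_mul, zero_sub,
      EuclideanSpace.inner_eq_star_dotProduct, star_trivial] at h
    rw [h]
    push_cast
    rfl
  have hinj : Function.Injective fun k : Fin M => c + ((k : ℕ) : ℤ) := by
    intro a b hab
    have : ((a : ℕ) : ℤ) = b := add_left_cancel hab
    exact Fin.ext (by exact_mod_cast this)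
  have hind := hX.innovation_indep.precomp hinj
  have h := hind.integral_fun_prod_comp (𝕜 := ℂ)
    (f := fun (k : Fin M) x => Complex.exp (((g (c + ((k : ℕ) : ℤ)) ⬝ᵥ x.ofLp : ℝ) : ℂ) * Complex.I))
    (fun k => (hX.innovation_law _).aemeasurable)
    (fun k => Continuous.aestronglyMeasurable (by
      simp only [dotProduct]
      fun_prop))
  simp only [hone, ← Complex.exp_sum, ← Finset.sum_mul] at h
  simp only [Finset.sum_range]
  push_cast at h ⊢
  rw [h, Finset.sum_neg_distrib, Finset.sum_div]

lemma IsVARProcess.isGaussianAutoregression (hX : IsVARProcess A Sig X ε P)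
    (hSig : Sig.PosSemidef) :
    IsGaussianAutoregression A (fun x => x ⬝ᵥ (Sig *ᵥ x)) (fun t ω => (X t ω).ofLp)
      (fun t ω => (ε t ω).ofLp) P where
  integrable t i := (hX.stationary.memLp_apply t i).integrable one_le_two
  bounded := ⟨_, hX.stationary.integral_abs_le⟩
  equation t := by
    filter_upwards [hX.equation t] with ω hω
    ext i
    simpa using hω i
  charFun_noise := hX.charFun_noise hSig

/-- The noise enters only the first block, so the covariance form is degenerate as soon as d > 1.
This model therefore serves for upper variance bounds only. -/
lemma IsVARProcess.isGaussianAutoregression_companion (hd : 1 ≤ d) (hX : IsVARProcess A Sig X ε P)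
    (hSig : Sig.PosSemidef) :
    IsGaussianAutoregression (companionVAR A)
      (fun x => (fun i => x (⟨0, hd⟩, i)) ⬝ᵥ (Sig *ᵥ fun i => x (⟨0, hd⟩, i)))
      (fun t ω a => X (t - ((a.1 : ℕ) : ℤ)) ω a.2)
      (fun t ω a => if (a.1 : ℕ) = 0 then ε t ω a.2 else 0) P where
  integrable t a := (hX.stationary.memLp_apply _ a.2).integrable one_le_two
  bounded := ⟨_, fun t a => hX.stationary.integral_abs_le _ a.2⟩
  equation t := by
    filter_upwards [hX.equation t] with ω hω
    ext ⟨h, i⟩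
    simp only [Finset.univ_unique, Finset.sum_singleton, Fin.default_eq_zero, Fin.val_zero,
      zero_add, companionVAR, Pi.add_apply]
    by_cases h0 : (h : ℕ) = 0
    · rw [h0, Nat.cast_zero, sub_zero, hω i, if_pos rfl]
      congr 1
      simp only [Matrix.mulVec, dotProduct, Fintype.sum_prod_type, companion, Matrix.of_apply, h0,
        if_true]
      refine Finset.sum_congr rfl fun b _ => Finset.sum_congr rfl fun j _ => ?_
      have e1 : t - ((b : ℕ) + 1 : ℤ) = t - ((0 : ℕ) + 1 : ℕ) - ((b : ℕ) : ℤ) := by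
        push_cast; ring
      rw [e1]
    · rw [if_neg h0, add_zero]
      have hlt : (h : ℕ) - 1 < d := by omega
      simp only [Matrix.mulVec, dotProduct]
      rw [Finset.sum_eq_single (⟨(h : ℕ) - 1, hlt⟩, i)]
      · have h1 : (h : ℕ) = (h : ℕ) - 1 + 1 := by omega
        have h2 : companion A (h, i) (⟨(h : ℕ) - 1, hlt⟩, i) = 1 := by
          simp only [companion, Matrix.of_apply, if_neg h0, and_true]
          rw [if_pos h1]
        rw [h2, one_mul]
        have e1 : t - ((h : ℕ) : ℤ) = t - ((0 : ℕ) + 1 : ℕ) - (((h : ℕ) - 1 : ℕ) : ℤ) := by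
          omega
        rw [e1]
      · rintro ⟨b, j⟩ - hb
        have h2 : ¬ ((h : ℕ) = (b : ℕ) + 1 ∧ i = j) := by
          rintro ⟨h3, rfl⟩
          exact hb (Prod.ext (Fin.ext (by simp; omega)) rfl)
        simp [companion, h0, h2]
      · simp
  charFun_noise g c M := by
    rw [← hX.charFun_noise hSig (fun t i => g t (⟨0, hd⟩, i)) c M]
    have h : ∀ (t : ℤ) (ω : Ω), (g t ⬝ᵥ fun a : Fin d × Fin p =>
        if (a.1 : ℕ) = 0 then ε t ω a.2 else 0) =
        (fun i => g t (⟨0, hd⟩, i)) ⬝ᵥ (ε t ω).ofLp := by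
      intro t ω
      simp only [dotProduct, Fintype.sum_prod_type]
      rw [Finset.sum_eq_single ⟨0, hd⟩]
      · simp
      · intro b _ hb
        have : (b : ℕ) ≠ 0 := fun h => hb (Fin.ext h)
        simp [this]
      · simp
    simp only [h]

end Stationary

/-! ### Weights placed in reversed time -/

section Window

variable {n : Type*}

/-- The time series that takes the values `f 0, f 1, …` at the times `T - 1 - r`,
`T - 1 - r - 1`, …, and vanishes otherwise. -/
def windowSeq (T r : ℕ) {m : ℕ} (f : Fin m → n → ℝ) (t : ℤ) : n → ℝ :=
  if h : 0 ≤ (T : ℤ) - 1 - r - t ∧ (T : ℤ) - 1 - r - t < m then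
    f ⟨((T : ℤ) - 1 - r - t).toNat, by omega⟩ else 0

lemma windowSeq_eq_zero {T r m : ℕ} (hm : r + m ≤ T) (f : Fin m → n → ℝ) (t : ℤ)
    (ht : t < 0 ∨ (T : ℤ) ≤ t) : windowSeq T r f t = 0 := by
  rw [windowSeq, dif_neg]
  omega

/-- Used with φ the squared norm, for the variance bounds, and with φ the pairing with the process
at time t. -/
lemma sum_windowSeq {T r m : ℕ} (hm : r + m ≤ T) (f : Fin m → n → ℝ) (φ : ℤ → (n → ℝ) → ℝ)
    (hφ : ∀ t, φ t 0 = 0) :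
    ∑ k ∈ Finset.range T, φ k (windowSeq T r f k) =
      ∑ h : Fin m, φ ((T : ℤ) - 1 - r - (h : ℕ)) (f h) := by
  symm
  refine Finset.sum_of_injOn (fun h : Fin m => T - 1 - r - h) ?_ ?_ ?_ ?_
  · intro a _ b _ hab
    ext
    simp only at hab
    omega
  · intro a _
    simp only [Finset.coe_range, Set.mem_Iio]
    omega
  · intro k hk hk'
    rw [windowSeq, dif_neg, hφ]
    rintro ⟨h1, h2⟩
    refine hk' ⟨⟨((T : ℤ) - 1 - r - k).toNat, by omega⟩, Finset.mem_coe.2 (Finset.mem_univ _), ?_⟩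
    simp only
    omega
  · intro h _
    have h1 : ((T - 1 - r - h : ℕ) : ℤ) = (T : ℤ) - 1 - r - (h : ℕ) := by omega
    have h2 : windowSeq T r f ((T : ℤ) - 1 - r - (h : ℕ)) = f h := by
      rw [windowSeq, dif_pos (by omega)]
      congr 1
      ext
      simp
    rw [h1, h2]

end Window

/-! ### Variance bounds for the regressors -/

section Design

variable {Ω : Type*} [MeasurableSpace Ω] {P : Measure Ω} [IsProbabilityMeasure P] {p d : ℕ}
  {A : Fin d → Matrix (Fin p) (Fin p) ℝ} {Sig : Matrix (Fin p) (Fin p) ℝ}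
  {X ε : ℤ → Ω → EuclideanSpace ℝ (Fin p)}

lemma lambdaMin_mul_sum_sq_le {Sig : Matrix (Fin p) (Fin p) ℝ} (hSig : Sig.IsHermitian)
    (x : Fin p → ℝ) : lambdaMin hSig * ∑ i, x i ^ 2 ≤ x ⬝ᵥ (Sig *ᵥ x) := by
  simpa using lambdaMin_mul_le hSig x

lemma le_lambdaMax_mul_sum_sq {Sig : Matrix (Fin p) (Fin p) ℝ} (hSig : Sig.IsHermitian)
    (x : Fin p → ℝ) : x ⬝ᵥ (Sig *ᵥ x) ≤ lambdaMax hSig * ∑ i, x i ^ 2 := by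
  simpa using le_lambdaMax_mul hSig x

lemma lambdaMin_pos (hp : 1 ≤ p) (hSig : Sig.PosDef) : 0 < lambdaMin hSig.isHermitian := by
  have : Nonempty (Fin p) := ⟨⟨0, hp⟩⟩
  obtain ⟨i, hi⟩ := exists_eq_ciInf_of_finite (f := hSig.isHermitian.eigenvalues)
  rw [lambdaMin, ← hi]
  exact hSig.eigenvalues_pos i

lemma lambdaMax_nonneg (hSig : Sig.PosDef) : 0 ≤ lambdaMax hSig.isHermitian :=
  Real.iSup_nonneg fun i => (hSig.eigenvalues_pos i).le

lemma dotProduct_mulVec_smul_smul (ξ : ℝ) (x : Fin p → ℝ) :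
    (ξ • x) ⬝ᵥ (Sig *ᵥ (ξ • x)) = ξ ^ 2 * (x ⬝ᵥ (Sig *ᵥ x)) := by
  rw [Matrix.mulVec_smul, smul_dotProduct, dotProduct_smul, smul_eq_mul, smul_eq_mul]
  ring

/-- Linear functionals of the regressor values `𝒳 v` are centred Gaussian. -/
theorem IsVARProcess.exists_map_sum_eq_gaussianReal {T : ℕ} (hp : 1 ≤ p) (hd : 1 ≤ d) (hT : d ≤ T)
    (hA : IsStable A) (hSig : Sig.PosDef) (hX : IsVARProcess A Sig X ε P)
    (v : Fin d × Fin p → ℝ) (u : Fin (numSamples d T) → ℝ) :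
    ∃ V : ℝ, 0 ≤ V ∧
      V ≤ lambdaMax hSig.isHermitian / muMin (companionVAR A) * (∑ a, v a ^ 2) * ∑ r, u r ^ 2 ∧
      P.map (fun ω => ∑ r, u r * (designMatrix d T (fun t => X t ω) *ᵥ v) r) =
        gaussianReal 0 V.toNNReal := by
  have : Nonempty (Fin d × Fin p) := ⟨(⟨0, hd⟩, ⟨0, hp⟩)⟩
  have hN : 0 + numSamples d T ≤ T := by rw [numSamples]; omega
  -- Row r of 𝒳 is the companion state at time T-1-r, so the weight there is u_r v and the total
  -- squared weight is ‖u‖²‖v‖². The lower constant is 0, the noise being degenerate.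
  obtain ⟨V, hV, hlaw⟩ :=
    (hX.isGaussianAutoregression_companion hd hSig.posSemidef).exists_map_eq_gaussianReal
      (hA.companionVAR hd) (fun ξ x => dotProduct_mulVec_smul_smul ξ _) (le_refl 0)
      (fun x => by
        rw [zero_mul]
        exact (mul_nonneg (lambdaMin_pos hp hSig).le (by positivity)).trans
          (lambdaMin_mul_sum_sq_le hSig.isHermitian _))
      (fun x => (le_lambdaMax_mul_sum_sq hSig.isHermitian _).trans
        (mul_le_mul_of_nonneg_left (by
          rw [Fintype.sum_prod_type]
          exact Finset.single_le_sum (f := fun h : Fin d => ∑ i, x (h, i) ^ 2)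
            (fun _ _ => by positivity) (Finset.mem_univ _)) (lambdaMax_nonneg hSig)))
      (lambdaMax_nonneg hSig) (by omega : 0 < T) (windowSeq T 0 fun r => u r • v)
      (windowSeq_eq_zero hN _)
  rw [sum_windowSeq hN _ (fun _ x => ∑ i, x i ^ 2) (by simp), zero_mul] at hV
  refine ⟨V, hV.1, hV.2.trans (le_of_eq ?_), ?_⟩
  · simp only [Pi.smul_apply, smul_eq_mul, mul_pow, ← Finset.mul_sum, ← Finset.sum_mul]
    ring
  · rw [← hlaw]
    congr 1
    funext ω
    rw [sum_windowSeq hN _ (fun t x => x ⬝ᵥ fun a : Fin d × Fin p => X (t - ((a.1 : ℕ) : ℤ)) ω a.2)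
      (by simp)]
    refine Finset.sum_congr rfl fun r _ => ?_
    rw [smul_dotProduct, smul_eq_mul, dotProduct_comm]
    simp [Matrix.mulVec, designMatrix, dotProduct]

/-- Each entry of `𝒳 v` has variance at least `Λ_min(Sig) / μ_max(𝒜) * ‖v‖²`. -/
theorem IsVARProcess.exists_map_mulVec_eq_gaussianReal {T : ℕ} (hp : 1 ≤ p) (hd : 1 ≤ d)
    (hT : d ≤ T) (hA : IsStable A) (hSig : Sig.PosDef) (hX : IsVARProcess A Sig X ε P)
    (v : Fin d × Fin p → ℝ) (r : Fin (numSamples d T)) :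
    ∃ V : ℝ, lambdaMin hSig.isHermitian / muMax A * (∑ a, v a ^ 2) ≤ V ∧
      P.map (fun ω => (designMatrix d T (fun t => X t ω) *ᵥ v) r) =
        gaussianReal 0 V.toNNReal := by
  have : Nonempty (Fin p) := ⟨⟨0, hp⟩⟩
  have hN : (r : ℕ) + d ≤ T := by
    have : (r : ℕ) < T - d + 1 := r.2
    omega
  -- A single entry involves d distinct times of X, so the original model with its nondegenerate
  -- noise applies, the blocks of v being the weights.
  obtain ⟨V, hV, hlaw⟩ :=
    (hX.isGaussianAutoregression hSig.posSemidef).exists_map_eq_gaussianReal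
      hA dotProduct_mulVec_smul_smul (lambdaMin_pos hp hSig).le
      (lambdaMin_mul_sum_sq_le hSig.isHermitian) (le_lambdaMax_mul_sum_sq hSig.isHermitian)
      (lambdaMax_nonneg hSig) (by omega : 0 < T) (windowSeq T r fun h i => v (h, i))
      (windowSeq_eq_zero hN _)
  rw [sum_windowSeq hN _ (fun _ x => ∑ i, x i ^ 2) (by simp)] at hV
  refine ⟨V, (le_of_eq ?_).trans hV.1, ?_⟩
  · rw [Fintype.sum_prod_type]
    ring
  · rw [← hlaw]
    congr 1
    funext ω
    rw [sum_windowSeq hN _ (fun t x => x ⬝ᵥ (X t ω).ofLp) (by simp)]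
    simp only [Matrix.mulVec, dotProduct, designMatrix, Matrix.of_apply, Fintype.sum_prod_type]
    exact Finset.sum_congr rfl fun h _ => Finset.sum_congr rfl fun i _ => mul_comm _ _

end Design

/-! ### Concentration of the squared norm of a Gaussian vector -/

section Concentration

open scoped RealInnerProductSpace NNReal

/-- That is, log(1-x) ≥ -x-x². It turns the exact transform (1-2sv)^(-1/2) of a squared Gaussian
into a sub-gamma bound. -/
lemma exp_neg_sub_sq_le {x : ℝ} (hx : |x| ≤ 1 / 2) : Real.exp (-(x + x ^ 2)) ≤ 1 - x := by
  obtain ⟨h1, h2⟩ := abs_le.1 hx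
  rcases le_or_gt 0 x with h0 | h0
  · rw [Real.exp_neg, inv_le_comm₀ (Real.exp_pos _) (by linarith)]
    refine le_trans ?_ (Real.quadratic_le_exp_of_nonneg (by positivity : 0 ≤ x + x ^ 2))
    rw [inv_le_iff_one_le_mul₀' (by linarith)]
    have h3 : (1 - x) * (1 + (x + x ^ 2) + (x + x ^ 2) ^ 2 / 2) - 1 =
        x ^ 2 / 2 * ((1 - x) * (1 + x) ^ 2 - 2 * x) := by ring
    have h4 : 0 ≤ (1 - x) * (1 + x) ^ 2 - 2 * x := by
      nlinarith [mul_nonneg h0 (by linarith : 0 ≤ 1 / 2 - x), mul_nonneg (mul_nonneg h0 h0)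
        (by linarith : 0 ≤ 1 / 2 - x)]
    have := mul_nonneg (by positivity : 0 ≤ x ^ 2 / 2) h4
    linarith
  · rw [← Real.le_log_iff_exp_le (by linarith)]
    have h3 := Real.le_log_one_add_of_nonneg (x := -x) (by linarith)
    rw [← sub_eq_add_neg] at h3
    refine le_trans ?_ h3
    rw [le_div_iff₀ (by linarith)]
    nlinarith [mul_nonneg (sq_nonneg x) (by linarith : 0 ≤ 1 + x),
      mul_nonneg (sq_nonneg x) (by linarith : 0 ≤ 1 - x), mul_nonneg (sq_nonneg x) (by linarith : 0 ≤ -x)]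

/-- The moment generating function of the square of a centred Gaussian variable. -/
lemma integral_exp_mul_sq_gaussianReal_le {v : ℝ≥0} {s : ℝ} (hs : |s * v| ≤ 1 / 4) :
    Integrable (fun x => Real.exp (s * x ^ 2)) (gaussianReal 0 v) ∧
      ∫ x, Real.exp (s * x ^ 2) ∂gaussianReal 0 v ≤ Real.exp (s * v + 2 * (s * v) ^ 2) := by
  rcases eq_or_ne v 0 with rfl | hv
  · rw [gaussianReal_zero_var]
    exact ⟨integrable_dirac (by simp), by simp⟩
  have hv0 : (0 : ℝ) < v := by positivity
  obtain ⟨hs1, hs2⟩ := abs_le.1 hs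
  have hb : 0 < (2 * (v : ℝ))⁻¹ - s := by
    rw [sub_pos, ← one_div, lt_div_iff₀ (by positivity)]
    linarith
  have hpdf : ∀ x, gaussianPDFReal 0 v x * Real.exp (s * x ^ 2) =
      (√(2 * Real.pi * v))⁻¹ * Real.exp (-((2 * (v : ℝ))⁻¹ - s) * x ^ 2) := by
    intro x
    rw [gaussianPDFReal, mul_assoc, ← Real.exp_add]
    congr 2
    field_simp
    ring
  constructor
  · rw [gaussianReal_of_var_ne_zero _ hv, integrable_withDensity_iff (by fun_prop)
      (.of_forall fun x => gaussianPDF_lt_top)]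
    simp_rw [toReal_gaussianPDF, mul_comm (Real.exp _), hpdf]
    exact (integrable_exp_neg_mul_sq hb).const_mul _
  · rw [integral_gaussianReal_eq_integral_smul hv]
    simp_rw [smul_eq_mul, hpdf]
    rw [integral_const_mul, integral_gaussian]
    have h1 : (√(2 * Real.pi * v))⁻¹ * √(Real.pi / ((2 * (v : ℝ))⁻¹ - s)) =
        √((1 - 2 * (s * v))⁻¹) := by
      rw [← Real.sqrt_inv, ← Real.sqrt_mul (by positivity)]
      congr 1
      have h3 : (1 - 2 * (s * v)) ≠ 0 := by linarith
      have h4 : (2 * (v : ℝ))⁻¹ - s = (1 - 2 * (s * v)) / (2 * v) := by field_simp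
      rw [h4]
      field_simp
    rw [h1]
    -- The assumption |sv| ≤ 1/4 is exactly |x| ≤ 1/2 here.
    have h2 := exp_neg_sub_sq_le (x := 2 * (s * v)) (abs_le.2 ⟨by linarith, by linarith⟩)
    have h3 : (1 - 2 * (s * v))⁻¹ ≤ Real.exp (2 * (s * v) + (2 * (s * v)) ^ 2) := by
      rw [← inv_inv (Real.exp _), ← Real.exp_neg]
      exact inv_anti₀ (Real.exp_pos _) h2
    rw [Real.sqrt_le_left (Real.exp_pos _).le, ← Real.exp_nat_mul]
    refine h3.trans (le_of_eq ?_)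
    congr 1
    push_cast
    ring

variable {N : ℕ} {μ : Measure (EuclideanSpace ℝ (Fin N))} [IsProbabilityMeasure μ]

/-- The squared norm of a centred Gaussian vector, whose covariance is bounded by `β`, has a
sub-gamma moment generating function. -/
lemma mgf_norm_sq_le {β : ℝ}
    (h : ∀ u : EuclideanSpace ℝ (Fin N), ∃ V : ℝ, 0 ≤ V ∧ V ≤ β * ‖u‖ ^ 2 ∧
      μ.map (fun y => ⟪u, y⟫) = gaussianReal 0 V.toNNReal)
    {s : ℝ} (hs : |s| * β ≤ 1 / 4) :
    Integrable (fun y => Real.exp (s * ‖y‖ ^ 2)) μ ∧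
      mgf (fun y => ‖y‖ ^ 2) μ s ≤
        Real.exp (s * ∫ y, ‖y‖ ^ 2 ∂μ + 2 * N * (s * β) ^ 2) := by
  have hG : IsGaussian μ := isGaussian_of_map_eq_gaussianReal fun L => by
    obtain ⟨V, -, -, hV⟩ := h ((InnerProductSpace.toDual ℝ _).symm L)
    refine ⟨0, V.toNNReal, ?_⟩
    rw [← hV]
    congr 1
    funext y
    rw [InnerProductSpace.toDual_symm_apply]
  have hL2 : MemLp id 2 μ := IsGaussian.memLp_two_id
  have hsymm := (isPositive_covarianceOperator (μ := μ)).1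
  -- In the eigenbasis of the covariance the coordinates are uncorrelated and jointly Gaussian,
  -- hence independent, and ‖y‖² is the sum of their squares.
  set b := hsymm.eigenvectorBasis finrank_euclideanSpace_fin with hb
  set Z : Fin N → EuclideanSpace ℝ (Fin N) → ℝ := fun i y => ⟪b i, y⟫ with hZ
  have hZm : ∀ i, Measurable (Z i) := fun i => by fun_prop
  have hZL2 : ∀ i, MemLp (Z i) 2 μ := fun i => hL2.const_inner (𝕜 := ℝ) (b i)
  choose V hV0 hVβ hVlaw using fun i => h (b i)
  have hVβ' : ∀ i, V i ≤ β := fun i => by simpa [b.orthonormal.1 i] using hVβ i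
  have hmean : ∀ i, ∫ y, Z i y ∂μ = 0 := by
    intro i
    have := integral_map (μ := μ) (hZm i).aemeasurable (f := fun x : ℝ => x) (by fun_prop)
    rw [← this, hVlaw i, integral_id_gaussianReal]
  have hsec : ∀ i, ∫ y, Z i y ^ 2 ∂μ = V i := by
    intro i
    have h1 := variance_map (μ := μ) (X := fun x : ℝ => x) (by fun_prop) (hZm i).aemeasurable
    rw [hVlaw i, variance_fun_id_gaussianReal, Real.coe_toNNReal _ (hV0 i)] at h1
    have h2 : Var[Z i; μ] = V i := h1.symm
    rw [variance_eq_sub (hZL2 i), hmean i] at h2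
    simpa using h2
  have hlaw : HasGaussianLaw (fun y => (fun i => Z i y)) μ :=
    (IsGaussian.hasGaussianLaw_id (μ := μ)).map_fun
      (ContinuousLinearMap.pi fun i => innerSL ℝ (b i))
  have hind : iIndepFun Z μ := by
    refine hlaw.iIndepFun_of_covariance_eq_zero fun i j hij => ?_
    rw [covariance_eq_sub (hZL2 i) (hZL2 j), hmean i, zero_mul, sub_zero]
    have h1 := covarianceOperator_inner hL2 (b i) (b j)
    have h2 : covarianceOperator μ (b i) =
        (hsymm.eigenvalues finrank_euclideanSpace_fin i : ℝ) • b i :=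
      hsymm.apply_eigenvectorBasis finrank_euclideanSpace_fin i
    rw [h2, inner_smul_left, b.orthonormal.2 hij, mul_zero] at h1
    exact h1.symm
  have hsq : iIndepFun (fun i y => Z i y ^ 2) μ :=
    hind.comp (fun _ x => x ^ 2) fun _ => by fun_prop
  have hsqm : ∀ i, Measurable fun y => Z i y ^ 2 := fun i => (hZm i).pow_const 2
  have hnorm : (fun y : EuclideanSpace ℝ (Fin N) => ‖y‖ ^ 2) = ∑ i, fun y => Z i y ^ 2 := by
    funext y
    rw [Finset.sum_apply, ← b.sum_sq_norm_inner_right y]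
    simp [hZ]
  have hVs : ∀ i, |s * (V i).toNNReal| ≤ 1 / 4 := fun i => by
    rw [Real.coe_toNNReal _ (hV0 i), abs_mul, abs_of_nonneg (hV0 i)]
    exact (mul_le_mul_of_nonneg_left (hVβ' i) (abs_nonneg s)).trans hs
  have hint : ∀ i, Integrable (fun y => Real.exp (s * Z i y ^ 2)) μ := by
    intro i
    have h1 := (integral_exp_mul_sq_gaussianReal_le (hVs i)).1
    rw [← hVlaw i] at h1
    exact h1.comp_measurable (hZm i)
  have hmgf : ∀ i, mgf (fun y => Z i y ^ 2) μ s ≤ Real.exp (s * V i + 2 * (s * β) ^ 2) := by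
    intro i
    have h1 := (integral_exp_mul_sq_gaussianReal_le (hVs i)).2
    rw [← hVlaw i, integral_map (hZm i).aemeasurable (by fun_prop),
      Real.coe_toNNReal _ (hV0 i)] at h1
    refine h1.trans (Real.exp_le_exp.2 ?_)
    have h2 : (s * V i) ^ 2 ≤ (s * β) ^ 2 := by
      rw [mul_pow, mul_pow]
      gcongr
      · exact hV0 i
      · exact hVβ' i
    linarith
  have hsum : ∫ y, ‖y‖ ^ 2 ∂μ = ∑ i, V i := by
    have h1 : ∀ y, ‖y‖ ^ 2 = ∑ i, Z i y ^ 2 := fun y => by simpa using congrFun hnorm y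
    simp_rw [h1]
    rw [integral_finsetSum _ fun i _ => (hZL2 i).integrable_sq]
    exact Finset.sum_congr rfl fun i _ => hsec i
  constructor
  · have := hsq.integrable_exp_mul_sum hsqm (s := Finset.univ) (t := s) fun i _ => hint i
    rw [← hnorm] at this
    exact this
  · rw [hsum, hnorm, hsq.mgf_sum hsqm]
    refine (Finset.prod_le_prod (fun _ _ => mgf_nonneg) fun i _ => hmgf i).trans (le_of_eq ?_)
    rw [← Real.exp_sum, Finset.sum_add_distrib, ← Finset.mul_sum]
    congr 2
    simp
    ring

/-- Concentration of the squared norm of a centred Gaussian vector. -/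
theorem norm_sq_concentration {β : ℝ} (hβ : 0 < β)
    (h : ∀ u : EuclideanSpace ℝ (Fin N), ∃ V : ℝ, 0 ≤ V ∧ V ≤ β * ‖u‖ ^ 2 ∧
      μ.map (fun y => ⟪u, y⟫) = gaussianReal 0 V.toNNReal)
    {η : ℝ} (hη : 0 ≤ η) (hη' : η ≤ 1) :
    μ.real {y | ‖y‖ ^ 2 ≤ ∫ y, ‖y‖ ^ 2 ∂μ - η * N * β} ≤ Real.exp (-(N * η ^ 2 / 8)) ∧
      μ.real {y | ∫ y, ‖y‖ ^ 2 ∂μ + η * N * β ≤ ‖y‖ ^ 2} ≤ Real.exp (-(N * η ^ 2 / 8)) := by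
  -- The value s = η/(4β) minimises -sηNβ + 2N(sβ)², with minimum -Nη²/8; η ≤ 1 keeps it in the
  -- admissible range.
  have hs : |η / (4 * β)| * β ≤ 1 / 4 := by
    rw [abs_of_nonneg (by positivity), div_mul_eq_mul_div, div_le_div_iff₀ (by positivity)
      (by positivity)]
    nlinarith
  have hsβ : η / (4 * β) * β = η / 4 := by field_simp
  constructor
  · obtain ⟨h1, h2⟩ := mgf_norm_sq_le h (s := -(η / (4 * β))) (by rwa [abs_neg])
    refine (measure_le_le_exp_mul_mgf _ (neg_nonpos.2 (by positivity)) h1).trans ?_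
    refine (mul_le_mul_of_nonneg_left h2 (Real.exp_pos _).le).trans (le_of_eq ?_)
    rw [← Real.exp_add]
    congr 1
    rw [neg_mul (η / (4 * β)) β, hsβ]
    generalize ∫ y, ‖y‖ ^ 2 ∂μ = m
    have : η / (4 * β) * (η * N * β) = N * η ^ 2 / 4 := by field_simp
    linear_combination -this
  · obtain ⟨h1, h2⟩ := mgf_norm_sq_le h (s := η / (4 * β)) hs
    refine (measure_ge_le_exp_mul_mgf _ (by positivity) h1).trans ?_
    refine (mul_le_mul_of_nonneg_left h2 (Real.exp_pos _).le).trans (le_of_eq ?_)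
    rw [← Real.exp_add]
    congr 1
    rw [hsβ]
    generalize ∫ y, ‖y‖ ^ 2 ∂μ = m
    have : η / (4 * β) * (η * N * β) = N * η ^ 2 / 4 := by field_simp
    linear_combination -this

end Concentration

/-! ### The Gram matrix at a fixed vector -/

section GramConcentration

open scoped RealInnerProductSpace NNReal

variable {Ω : Type*} [MeasurableSpace Ω] {P : Measure Ω} [IsProbabilityMeasure P] {p d T : ℕ}
  {A : Fin d → Matrix (Fin p) (Fin p) ℝ} {Sig : Matrix (Fin p) (Fin p) ℝ}
  {X ε : ℤ → Ω → EuclideanSpace ℝ (Fin p)}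

lemma integral_sq_eq_of_map_eq_gaussianReal {Z : Ω → ℝ} (hZ : AEMeasurable Z P) {v : ℝ≥0}
    (h : P.map Z = gaussianReal 0 v) : ∫ ω, Z ω ^ 2 ∂P = v := by
  rw [← integral_map (f := fun x : ℝ => x ^ 2) hZ (by fun_prop), h]
  have h1 := variance_eq_sub (memLp_id_gaussianReal (μ := 0) (v := v) 2)
  rw [variance_id_gaussianReal] at h1
  simpa using h1.symm

/-- The expectation of the Gram matrix. -/
noncomputable def meanGram (d T : ℕ) (X : ℤ → Ω → EuclideanSpace ℝ (Fin p)) (P : Measure Ω) :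
    Matrix (Fin d × Fin p) (Fin d × Fin p) ℝ :=
  Matrix.of fun a b => ∫ ω, gram d T (fun t => X t ω) a b ∂P

lemma dotProduct_gram_mulVec (d T : ℕ) (x : ℤ → EuclideanSpace ℝ (Fin p))
    (v : Fin d × Fin p → ℝ) :
    v ⬝ᵥ (gram d T x *ᵥ v) = (numSamples d T : ℝ)⁻¹ * ∑ r, (designMatrix d T x *ᵥ v) r ^ 2 := by
  rw [gram, Matrix.smul_mulVec, dotProduct_smul, smul_eq_mul, ← Matrix.mulVec_mulVec,
    Matrix.dotProduct_mulVec, Matrix.vecMul_transpose, dotProduct]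
  simp only [pow_two]

lemma numSamples_pos (d T : ℕ) : (0 : ℝ) < numSamples d T := by
  rw [numSamples]
  positivity

lemma IsCovStationary.memLp_design (hX : IsCovStationary X P) (v : Fin d × Fin p → ℝ)
    (r : Fin (numSamples d T)) :
    MemLp (fun ω => (designMatrix d T (fun t => X t ω) *ᵥ v) r) 2 P := by
  simp only [Matrix.mulVec, dotProduct, designMatrix, Matrix.of_apply]
  exact memLp_finsetSum _ fun a _ => (hX.memLp_apply _ _).mul_const _

lemma IsCovStationary.integrable_gram (hX : IsCovStationary X P) (a b : Fin d × Fin p) :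
    Integrable (fun ω => gram d T (fun t => X t ω) a b) P := by
  simp only [gram, Matrix.smul_apply, Matrix.mul_apply, smul_eq_mul, designMatrix,
    Matrix.transpose_apply, Matrix.of_apply]
  exact (integrable_finsetSum _ fun r _ =>
    (hX.memLp_apply _ _).integrable_mul (hX.memLp_apply _ _)).const_mul _

lemma IsCovStationary.dotProduct_meanGram_mulVec (hX : IsCovStationary X P)
    (v : Fin d × Fin p → ℝ) :
    v ⬝ᵥ (meanGram d T X P *ᵥ v) = (numSamples d T : ℝ)⁻¹ *
      ∫ ω, ∑ r, (designMatrix d T (fun t => X t ω) *ᵥ v) r ^ 2 ∂P := by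
  rw [← integral_const_mul]
  simp_rw [← dotProduct_gram_mulVec]
  simp only [dotProduct, Matrix.mulVec, meanGram, Matrix.of_apply]
  rw [integral_finsetSum _ fun a _ => (integrable_finsetSum _ fun b _ =>
    (hX.integrable_gram a b).mul_const _).const_mul _]
  refine Finset.sum_congr rfl fun a _ => ?_
  rw [integral_const_mul, integral_finsetSum _ fun b _ => (hX.integrable_gram a b).mul_const _]
  simp_rw [integral_mul_const]

variable (hp : 1 ≤ p) (hd : 1 ≤ d) (hT : d ≤ T) (hA : IsStable A) (hSig : Sig.PosDef)
  (hX : IsVARProcess A Sig X ε P)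

include hp hd hT hA hX

lemma IsVARProcess.lambdaMin_mul_le_meanGram (v : Fin d × Fin p → ℝ) :
    lambdaMin hSig.isHermitian / muMax A * ∑ a, v a ^ 2 ≤ v ⬝ᵥ (meanGram d T X P *ᵥ v) := by
  rw [hX.stationary.dotProduct_meanGram_mulVec, integral_finsetSum _ fun r _ =>
    (hX.stationary.memLp_design v r).integrable_sq, inv_mul_eq_div,
    le_div_iff₀ (numSamples_pos d T)]
  have h : ∀ r : Fin (numSamples d T), lambdaMin hSig.isHermitian / muMax A * ∑ a, v a ^ 2 ≤
      ∫ ω, (designMatrix d T (fun t => X t ω) *ᵥ v) r ^ 2 ∂P := by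
    intro r
    obtain ⟨V, hV, hlaw⟩ := hX.exists_map_mulVec_eq_gaussianReal hp hd hT hA hSig v r
    rw [integral_sq_eq_of_map_eq_gaussianReal
      (hX.stationary.memLp_design v r).1.aemeasurable hlaw]
    exact hV.trans (Real.le_coe_toNNReal V)
  calc _ = ∑ _r : Fin (numSamples d T), lambdaMin hSig.isHermitian / muMax A * ∑ a, v a ^ 2 := by
        simp [mul_comm]
    _ ≤ _ := Finset.sum_le_sum fun r _ => h r

/-- Both sides bound the variance of one and the same entry of 𝒳. This yields B > 0 and makes η =
b/(4B) admissible. -/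
lemma IsVARProcess.lambdaMin_div_muMax_le :
    lambdaMin hSig.isHermitian / muMax A ≤
      lambdaMax hSig.isHermitian / muMin (companionVAR A) := by
  set r : Fin (numSamples d T) := ⟨0, Nat.succ_pos _⟩
  set v : Fin d × Fin p → ℝ := Pi.single (⟨0, hd⟩, ⟨0, hp⟩) 1
  have hv : ∑ a, v a ^ 2 = 1 := by
    rw [Finset.sum_eq_single (⟨0, hd⟩, ⟨0, hp⟩)] <;> simp +contextual [v]
  have hu : ∑ s, (Pi.single r 1 : Fin (numSamples d T) → ℝ) s ^ 2 = 1 := by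
    rw [Finset.sum_eq_single r] <;> simp +contextual
  obtain ⟨V, hV, hlaw⟩ := hX.exists_map_mulVec_eq_gaussianReal hp hd hT hA hSig v r
  obtain ⟨V', hV0, hV', hlaw'⟩ :=
    hX.exists_map_sum_eq_gaussianReal hp hd hT hA hSig v (Pi.single r 1)
  have hfun : (fun ω => ∑ s, (Pi.single r 1 : Fin (numSamples d T) → ℝ) s *
      (designMatrix d T (fun t => X t ω) *ᵥ v) s) =
      fun ω => (designMatrix d T (fun t => X t ω) *ᵥ v) r := by
    funext ω
    rw [Finset.sum_eq_single r] <;> simp +contextual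
  rw [hfun, hlaw] at hlaw'
  have h := (gaussianReal_ext_iff.1 hlaw').2
  rw [hv, mul_one] at hV
  rw [hv, hu, mul_one, mul_one] at hV'
  calc _ ≤ V := hV
    _ ≤ V.toNNReal := Real.le_coe_toNNReal V
    _ = V' := by rw [h, Real.coe_toNNReal _ hV0]
    _ ≤ _ := hV'

/-- Concentration of the quadratic form of the Gram matrix at a fixed vector. -/
theorem IsVARProcess.gram_concentration (v : Fin d × Fin p → ℝ) {η : ℝ} (hη : 0 ≤ η)
    (hη' : η ≤ 1) :
    P.real {ω | v ⬝ᵥ (gram d T (fun t => X t ω) *ᵥ v) <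
        v ⬝ᵥ (meanGram d T X P *ᵥ v) -
          η * (lambdaMax hSig.isHermitian / muMin (companionVAR A)) * ∑ a, v a ^ 2} ≤
      Real.exp (-(numSamples d T * η ^ 2 / 8)) ∧
    P.real {ω | v ⬝ᵥ (meanGram d T X P *ᵥ v) +
        η * (lambdaMax hSig.isHermitian / muMin (companionVAR A)) * ∑ a, v a ^ 2 <
          v ⬝ᵥ (gram d T (fun t => X t ω) *ᵥ v)} ≤
      Real.exp (-(numSamples d T * η ^ 2 / 8)) := by
  -- For v = 0 the events are empty; otherwise the variance proxy B‖v‖² below is positive.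
  rcases eq_or_ne v 0 with rfl | hv
  · simp [Real.exp_nonneg]
  have : Nonempty (Fin p) := ⟨⟨0, hp⟩⟩
  set B := lambdaMax hSig.isHermitian / muMin (companionVAR A) with hB
  have hBpos : 0 < B := lt_of_lt_of_le (div_pos (lambdaMin_pos hp hSig) (muMax_pos hA))
    (hX.lambdaMin_div_muMax_le (T := T) hp hd hT hA hSig)
  have hvpos : 0 < ∑ a, v a ^ 2 := by
    obtain ⟨a, ha⟩ := Function.ne_iff.1 hv
    exact Finset.sum_pos' (fun _ _ => sq_nonneg _) ⟨a, Finset.mem_univ _, by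
      have : v a ≠ 0 := ha
      positivity⟩
  set y : Ω → EuclideanSpace ℝ (Fin (numSamples d T)) :=
    fun ω => WithLp.toLp 2 (designMatrix d T (fun t => X t ω) *ᵥ v) with hy
  have hym : AEMeasurable y P := by
    have h1 : AEMeasurable (fun ω => designMatrix d T (fun t => X t ω) *ᵥ v) P :=
      aemeasurable_pi_lambda _ fun r => (hX.stationary.memLp_design v r).1.aemeasurable
    exact (WithLp.measurable_toLp 2 _).comp_aemeasurable h1
  have hprob : IsProbabilityMeasure (P.map y) := Measure.isProbabilityMeasure_map hym
  have hnorm : ∀ ω, ‖y ω‖ ^ 2 = ∑ r, (designMatrix d T (fun t => X t ω) *ᵥ v) r ^ 2 := by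
    intro ω
    rw [EuclideanSpace.real_norm_sq_eq]
  have hmean : ∫ x, ‖x‖ ^ 2 ∂(P.map y) = numSamples d T * (v ⬝ᵥ (meanGram d T X P *ᵥ v)) := by
    rw [integral_map hym (by fun_prop), hX.stationary.dotProduct_meanGram_mulVec,
      mul_inv_cancel_left₀ (numSamples_pos d T).ne']
    simp_rw [hnorm]
  obtain ⟨h1, h2⟩ := norm_sq_concentration (μ := P.map y) (β := B * ∑ a, v a ^ 2)
    (mul_pos hBpos hvpos) (fun u => by
      obtain ⟨V, hV0, hV, hlaw⟩ := hX.exists_map_sum_eq_gaussianReal hp hd hT hA hSig v u.ofLp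
      refine ⟨V, hV0, ?_, ?_⟩
      · rwa [EuclideanSpace.real_norm_sq_eq]
      · rw [← hlaw, AEMeasurable.map_map_of_aemeasurable (by fun_prop) hym]
        congr 1
        funext ω
        simp only [Function.comp_apply, hy, PiLp.inner_apply, RCLike.inner_apply, conj_trivial]
        exact Finset.sum_congr rfl fun r _ => mul_comm _ _) hη hη'
  have hgram : ∀ ω, ‖y ω‖ ^ 2 =
      numSamples d T * (v ⬝ᵥ (gram d T (fun t => X t ω) *ᵥ v)) := by
    intro ω
    rw [hnorm, dotProduct_gram_mulVec, mul_inv_cancel_left₀ (numSamples_pos d T).ne']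
  rw [hmean] at h1 h2
  rw [map_measureReal_apply_of_aemeasurable hym (measurableSet_le (by fun_prop) (by fun_prop))]
    at h1 h2
  refine ⟨(measureReal_mono fun ω hω => ?_).trans h1, (measureReal_mono fun ω hω => ?_).trans h2⟩
  · simp only [Set.mem_preimage, Set.mem_ofPred_eq, hgram] at hω ⊢
    have := mul_le_mul_of_nonneg_left hω.le (numSamples_pos d T).le
    linarith
  · simp only [Set.mem_preimage, Set.mem_ofPred_eq, hgram] at hω ⊢
    have := mul_le_mul_of_nonneg_left hω.le (numSamples_pos d T).le
    linarith

end GramConcentration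

/-! ### From sums of signed basis vectors to all vectors -/

section Sparsification

variable {q : Type*} [Fintype q]

lemma dotProduct_mulVec_add (D : Matrix q q ℝ) (x y : q → ℝ) :
    (x + y) ⬝ᵥ (D *ᵥ (x + y)) =
      x ⬝ᵥ (D *ᵥ x) + x ⬝ᵥ (D *ᵥ y) + y ⬝ᵥ (D *ᵥ x) + y ⬝ᵥ (D *ᵥ y) := by
  rw [Matrix.mulVec_add, add_dotProduct, dotProduct_add, dotProduct_add]
  ring

/-- Maurey's empirical method: a sum of `m` atoms whose quadratic form does not exceed its mean
over independent random atoms. -/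
lemma exists_sum_atoms_le {ι : Type*} [Fintype ι] (D : Matrix q q ℝ) (x : ι → q → ℝ) (w : ι → ℝ)
    (hw : ∀ i, 0 ≤ w i) (hw1 : ∑ i, w i = 1) {θ : q → ℝ} (hθ : θ = ∑ i, w i • x i) (m : ℕ) :
    ∀ a : q → ℝ, ∃ f : Fin m → ι,
      (a + ∑ k, x (f k)) ⬝ᵥ (D *ᵥ (a + ∑ k, x (f k))) ≤
        (a + (m : ℝ) • θ) ⬝ᵥ (D *ᵥ (a + (m : ℝ) • θ)) +
          m * (∑ i, w i * (x i ⬝ᵥ (D *ᵥ x i)) - θ ⬝ᵥ (D *ᵥ θ)) := by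
  induction m with
  | zero => intro a; exact ⟨Fin.elim0, by simp⟩
  | succ m ih =>
    intro a
    -- The first atom is chosen while the other m are still replaced by their mean θ. Some atom does
    -- no worse than average, and the induction hypothesis, started from `a + x i`, fixes the rest.
    set c := a + (m : ℝ) • θ with hc
    have havg : ∑ i, w i * ((c + x i) ⬝ᵥ (D *ᵥ (c + x i))) =
        (c + θ) ⬝ᵥ (D *ᵥ (c + θ)) + (∑ i, w i * (x i ⬝ᵥ (D *ᵥ x i)) - θ ⬝ᵥ (D *ᵥ θ)) := by
      simp only [dotProduct_mulVec_add, mul_add, Finset.sum_add_distrib, ← Finset.sum_mul, hw1]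
      have h1 : ∑ i, w i * (c ⬝ᵥ (D *ᵥ x i)) = c ⬝ᵥ (D *ᵥ θ) := by
        rw [hθ, Matrix.mulVec_sum, dotProduct_sum]
        simp only [Matrix.mulVec_smul, dotProduct_smul, smul_eq_mul]
      have h2 : ∑ i, w i * (x i ⬝ᵥ (D *ᵥ c)) = θ ⬝ᵥ (D *ᵥ c) := by
        rw [hθ, sum_dotProduct]
        simp only [smul_dotProduct, smul_eq_mul]
      rw [h1, h2]
      ring
    obtain ⟨i, hi⟩ : ∃ i, (c + x i) ⬝ᵥ (D *ᵥ (c + x i)) ≤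
        ∑ i, w i * ((c + x i) ⬝ᵥ (D *ᵥ (c + x i))) := by
      by_contra! hcon
      obtain ⟨j, hj⟩ : ∃ j, w j ≠ 0 := by
        by_contra! h0
        simp [h0] at hw1
      have h3 : ∑ i, w i * (∑ i, w i * ((c + x i) ⬝ᵥ (D *ᵥ (c + x i)))) <
          ∑ i, w i * ((c + x i) ⬝ᵥ (D *ᵥ (c + x i))) :=
        Finset.sum_lt_sum (fun i _ => mul_le_mul_of_nonneg_left (hcon i).le (hw i))
          ⟨j, Finset.mem_univ _, mul_lt_mul_of_pos_left (hcon j) ((hw j).lt_of_ne' hj)⟩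
      rw [← Finset.sum_mul, hw1, one_mul] at h3
      exact lt_irrefl _ h3
    obtain ⟨f, hf⟩ := ih (a + x i)
    refine ⟨Fin.cons i f, ?_⟩
    rw [Fin.sum_univ_succ]
    simp only [Fin.cons_zero, Fin.cons_succ, ← add_assoc]
    refine hf.trans ?_
    have e1 : a + x i + (m : ℝ) • θ = c + x i := by rw [hc]; abel
    have e2 : a + ((m + 1 : ℕ) : ℝ) • θ = c + θ := by
      rw [hc]; push_cast; rw [add_smul, one_smul]; abel
    rw [e1, e2]
    rw [havg] at hi
    push_cast
    linarith

variable [DecidableEq q]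

/-- The signed standard basis vector. -/
def signedSingle (a : q × Bool) : q → ℝ := Pi.single a.1 (if a.2 then 1 else -1)

/-- A quadratic form that is nonnegative on all sums of `m` signed basis vectors is bounded below
by a multiple of the squared `ℓ¹` norm. -/
lemma neg_mul_le_of_forall_signedSingle (D : Matrix q q ℝ) {c : ℝ} {m : ℕ}
    (hm : 1 ≤ m)
    (hD : ∀ f : Fin m → q × Bool,
      0 ≤ (∑ k, signedSingle (f k)) ⬝ᵥ (D *ᵥ ∑ k, signedSingle (f k)))
    (hdiag : ∀ j, D j j ≤ c) (θ : q → ℝ) :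
    -(c * (∑ j, |θ j|) ^ 2) ≤ (m - 1) * (θ ⬝ᵥ (D *ᵥ θ)) := by
  set L := ∑ j, |θ j| with hL
  have hL0 : 0 ≤ L := by positivity
  rcases hL0.eq_or_lt with h0 | h0
  · have hθ : θ = 0 := by
      ext j
      have := (Finset.sum_eq_zero_iff_of_nonneg (fun j _ => abs_nonneg (θ j))).1 h0.symm j
        (Finset.mem_univ _)
      simpa using this
    rw [← h0, hθ]
    simp
  -- θ/L is the convex combination of these atoms with weights |θ_j|/L.
  set x : q → q → ℝ := fun j => signedSingle (j, decide (0 ≤ θ j)) with hx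
  have hxθ : L⁻¹ • θ = ∑ j, (|θ j| / L) • x j := by
    ext i
    rw [Finset.sum_apply, Finset.sum_eq_single i]
    · simp only [hx, signedSingle, Pi.smul_apply, smul_eq_mul, Pi.single_eq_same, decide_eq_true_eq]
      split_ifs with h
      · rw [abs_of_nonneg h]; ring
      · rw [abs_of_neg (not_le.1 h)]; ring
    · intro j _ hj
      simp [hx, signedSingle, hj.symm]
    · simp
  have hxd : ∀ j, x j ⬝ᵥ (D *ᵥ x j) = D j j := by
    intro j
    simp only [hx, signedSingle, Matrix.mulVec_single, single_dotProduct]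
    split_ifs <;> simp
  obtain ⟨f, hf⟩ := exists_sum_atoms_le D x (fun j => |θ j| / L) (fun j => by positivity)
    (by rw [← Finset.sum_div, ← hL, div_self h0.ne']) hxθ m 0
  have h1 := hD fun k => (f k, decide (0 ≤ θ (f k)))
  rw [zero_add, zero_add, ← smul_assoc] at hf
  have h2 := h1.trans hf
  have hsum : ∑ j, |θ j| / L * (x j ⬝ᵥ (D *ᵥ x j)) ≤ c := by
    calc ∑ j, |θ j| / L * (x j ⬝ᵥ (D *ᵥ x j)) ≤ ∑ j, |θ j| / L * c :=
          Finset.sum_le_sum fun j _ => mul_le_mul_of_nonneg_left (by rw [hxd]; exact hdiag j)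
            (by positivity)
      _ = c := by rw [← Finset.sum_mul, ← Finset.sum_div, ← hL, div_self h0.ne', one_mul]
  simp only [smul_eq_mul, Matrix.mulVec_smul, smul_dotProduct, dotProduct_smul] at h2
  set Q := θ ⬝ᵥ (D *ᵥ θ)
  have hm0 : (0 : ℝ) < m := by exact_mod_cast hm
  -- The mean contributes m²Q/L² and the fluctuation at most m(c - Q/L²); dividing by m/L² leaves
  -- (m-1)Q + cL² ≥ 0.
  have h3 : 0 ≤ m * L⁻¹ * (m * L⁻¹ * Q) + m * (c - L⁻¹ * (L⁻¹ * Q)) := by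
    refine h2.trans ?_
    gcongr
  have h4 : m * L⁻¹ * (m * L⁻¹ * Q) + m * (c - L⁻¹ * (L⁻¹ * Q)) =
      m * (L⁻¹ ^ 2 * ((m - 1) * Q + c * L ^ 2)) := by
    field_simp
    ring
  rw [h4] at h3
  have h5 := nonneg_of_mul_nonneg_right h3 hm0
  have h6 := nonneg_of_mul_nonneg_right h5 (by positivity)
  linarith

end Sparsification

/-! ### Kronecker products and diagonal dominance -/

section Kronecker

variable {p : ℕ} {q : Type*} [Fintype q]

lemma dotProduct_kronecker_mulVec (W : Matrix (Fin p) (Fin p) ℝ) (G : Matrix q q ℝ)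
    (θ : Fin p × q → ℝ) :
    θ ⬝ᵥ ((W ⊗ₖ G) *ᵥ θ) =
      ∑ i, ∑ j, W i j * ((fun a => θ (i, a)) ⬝ᵥ (G *ᵥ fun b => θ (j, b))) := by
  simp only [dotProduct, Matrix.mulVec, Fintype.sum_prod_type, Matrix.kroneckerMap_apply,
    Finset.mul_sum]
  refine Finset.sum_congr rfl fun i _ => ?_
  rw [Finset.sum_comm]
  refine Finset.sum_congr rfl fun j _ => Finset.sum_congr rfl fun a _ =>
    Finset.sum_congr rfl fun b _ => ?_
  ring

/-- Expand the nonnegative form at x + y and at x - y. -/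
lemma abs_dotProduct_mulVec_le {G : Matrix q q ℝ} (hG : G.IsSymm) (hpos : ∀ x, 0 ≤ x ⬝ᵥ (G *ᵥ x))
    (x y : q → ℝ) : |x ⬝ᵥ (G *ᵥ y)| ≤ (x ⬝ᵥ (G *ᵥ x) + y ⬝ᵥ (G *ᵥ y)) / 2 := by
  have hsymm : y ⬝ᵥ (G *ᵥ x) = x ⬝ᵥ (G *ᵥ y) := by
    rw [Matrix.dotProduct_mulVec, ← Matrix.mulVec_transpose, hG.eq, dotProduct_comm]
  have h1 := hpos (x + y)
  have h2 := hpos (x + -y)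
  rw [dotProduct_mulVec_add] at h1 h2
  simp only [Matrix.mulVec_neg, dotProduct_neg, neg_dotProduct, neg_neg] at h2
  rw [abs_le]
  constructor <;> linarith

/-- Diagonal dominance decouples the blocks of the quadratic form of `W ⊗ G`. -/
lemma sum_rowMargin_mul_le {W : Matrix (Fin p) (Fin p) ℝ} (hW : W.IsSymm) {G : Matrix q q ℝ}
    (hG : G.IsSymm) (hpos : ∀ x, 0 ≤ x ⬝ᵥ (G *ᵥ x)) (θ : Fin p × q → ℝ) :
    ∑ i, rowMargin W i * ((fun a => θ (i, a)) ⬝ᵥ (G *ᵥ fun b => θ (i, b))) ≤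
      θ ⬝ᵥ ((W ⊗ₖ G) *ᵥ θ) := by
  rw [dotProduct_kronecker_mulVec]
  set s : Fin p → Fin p → ℝ := fun i j => (fun a => θ (i, a)) ⬝ᵥ (G *ᵥ fun b => θ (j, b)) with hs
  set c : Fin p → Fin p → ℝ := fun i j => if i = j then 0 else |W i j| with hc
  have hmargin : ∀ i, rowMargin W i = W i i - ∑ j, c i j := by
    intro i
    rw [rowMargin, ← Finset.add_sum_erase _ _ (Finset.mem_univ i)]
    simp only [hc, if_true, zero_add]
    congr 1
    exact Finset.sum_congr rfl fun j hj => by rw [if_neg (Finset.ne_of_mem_erase hj).symm]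
  -- By symmetry of W, the halves charged to block j can be charged to block i, which makes the row
  -- margins appear.
  have hcomm : ∑ i, ∑ j, c i j * s j j = ∑ i, ∑ j, c i j * s i i := by
    rw [Finset.sum_comm]
    refine Finset.sum_congr rfl fun i _ => Finset.sum_congr rfl fun j _ => ?_
    simp only [hc, eq_comm (a := j) (b := i), hW.apply i j]
  have hterm : ∀ i j, (if i = j then W i i * s i i else 0) - c i j * ((s i i + s j j) / 2) ≤
      W i j * s i j := by
    intro i j
    by_cases hij : i = j
    · subst hij
      simp [hc]
    · simp only [hc, if_neg hij, zero_sub]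
      have h1 := abs_dotProduct_mulVec_le hG hpos (fun a => θ (i, a)) (fun a => θ (j, a))
      have h2 : |W i j * s i j| ≤ |W i j| * ((s i i + s j j) / 2) := by
        rw [abs_mul]
        exact mul_le_mul_of_nonneg_left h1 (abs_nonneg _)
      exact (neg_le_neg h2).trans (neg_abs_le _)
  calc ∑ i, rowMargin W i * s i i
      = ∑ i, ∑ j, ((if i = j then W i i * s i i else 0) - c i j * ((s i i + s j j) / 2)) := by
        simp only [hmargin, Finset.sum_sub_distrib, Finset.sum_ite_eq, Finset.mem_univ, if_true,
          sub_mul, mul_div_assoc', mul_add, add_div, Finset.sum_add_distrib, ← Finset.sum_div,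
          hcomm, Finset.sum_mul]
        ring
    _ ≤ _ := Finset.sum_le_sum fun i _ => Finset.sum_le_sum fun j _ => hterm i j

/-- RE is applied block by block and weighted with the margins: the smallest one survives in the
curvature, the largest in the tolerance. The squared block ℓ¹ norms add up to at most ‖θ‖₁². -/
lemma RE.kronecker [Nonempty (Fin p)] {W : Matrix (Fin p) (Fin p) ℝ} (hW : W.IsSymm)
    (hmargin : ∀ i, 0 < rowMargin W i) {G : Matrix q q ℝ} (hpos : ∀ x, 0 ≤ x ⬝ᵥ (G *ᵥ x))
    {α τ : ℝ} (hG : RE G α τ) :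
    RE (W ⊗ₖ G) (α * ⨅ i, rowMargin W i) (τ * ⨆ i, rowMargin W i) where
  symm := by
    rw [Matrix.IsSymm, ← Matrix.kroneckerMap_transpose, hW.eq, hG.symm.eq]
  curvature_pos := by
    obtain ⟨i, hi⟩ := exists_eq_ciInf_of_finite (f := rowMargin W)
    rw [← hi]
    exact mul_pos hG.curvature_pos (hmargin i)
  tolerance_nonneg := mul_nonneg hG.tolerance_nonneg (Real.iSup_nonneg fun i => (hmargin i).le)
  lower θ := by
    refine le_trans ?_ (sum_rowMargin_mul_le hW hG.symm hpos θ)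
    set lo := ⨅ i, rowMargin W i
    set hi := ⨆ i, rowMargin W i
    have hlo : ∀ i, lo ≤ rowMargin W i := ciInf_le (Set.finite_range _).bddBelow
    have hhi : ∀ i, rowMargin W i ≤ hi := le_ciSup (Set.finite_range _).bddAbove
    have hhi0 : 0 ≤ hi := Real.iSup_nonneg fun i => (hmargin i).le
    have hl1 : ∑ i, (∑ a, |θ (i, a)|) ^ 2 ≤ (∑ b, |θ b|) ^ 2 := by
      rw [Fintype.sum_prod_type]
      exact Finset.sum_sq_le_sq_sum_of_nonneg fun i _ => by positivity
    calc α * lo * ∑ b, θ b ^ 2 - τ * hi * (∑ b, |θ b|) ^ 2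
        ≤ α * lo * ∑ b, θ b ^ 2 - τ * hi * ∑ i, (∑ a, |θ (i, a)|) ^ 2 := by
          have := mul_le_mul_of_nonneg_left hl1 (mul_nonneg hG.tolerance_nonneg hhi0)
          linarith
      _ = ∑ i, (lo * (α * ∑ a, θ (i, a) ^ 2) - hi * (τ * (∑ a, |θ (i, a)|) ^ 2)) := by
          rw [Fintype.sum_prod_type, Finset.sum_sub_distrib, Finset.mul_sum, Finset.mul_sum]
          congr 1 <;> exact Finset.sum_congr rfl fun i _ => by ring
      _ ≤ _ := Finset.sum_le_sum fun i _ => by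
          have h1 := mul_le_mul_of_nonneg_right (hlo i)
            (mul_nonneg hG.curvature_pos.le
              (Finset.sum_nonneg (s := Finset.univ) fun a _ => sq_nonneg (θ (i, a))))
          have h2 := mul_le_mul_of_nonneg_right (hhi i)
            (mul_nonneg hG.tolerance_nonneg (sq_nonneg (∑ a, |θ (i, a)|)))
          have h3 := mul_le_mul_of_nonneg_left (hG.lower fun a => θ (i, a)) (hmargin i).le
          linarith

end Kronecker

/-! ### Deterministic criteria for RE -/

section Deterministic

variable {q : Type*} [Fintype q]

/-- Since ‖θ‖₂ ≤ ‖θ‖₁, a tolerance τ ≥ α makes the lower bound nonpositive. This disposes of small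
samples. -/
lemma RE.of_le {G : Matrix q q ℝ} (hG : G.IsSymm) (hpos : ∀ x, 0 ≤ x ⬝ᵥ (G *ᵥ x)) {α τ : ℝ}
    (hα : 0 < α) (hτ : α ≤ τ) : RE G α τ where
  symm := hG
  curvature_pos := hα
  tolerance_nonneg := hα.le.trans hτ
  lower θ := by
    refine le_trans ?_ (hpos θ)
    have h1 : ∑ i, θ i ^ 2 ≤ (∑ i, |θ i|) ^ 2 := by
      simpa using Finset.sum_sq_le_sq_sum_of_nonneg (s := Finset.univ)
        (f := fun i => |θ i|) fun i _ => abs_nonneg _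
    have h2 : α * ∑ i, θ i ^ 2 ≤ τ * (∑ i, |θ i|) ^ 2 :=
      mul_le_mul hτ h1 (by positivity) (hα.le.trans hτ)
    linarith

variable [DecidableEq q]

lemma dotProduct_mulVec_single (D : Matrix q q ℝ) (j : q) :
    (Pi.single j 1 : q → ℝ) ⬝ᵥ (D *ᵥ Pi.single j 1) = D j j := by
  simp

lemma sum_single_sq (j : q) : ∑ i, (Pi.single j 1 : q → ℝ) i ^ 2 = 1 := by
  rw [Finset.sum_eq_single j] <;> simp +contextual

/-- The restricted eigenvalue condition follows from a control of the quadratic form on sums of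
`m` signed basis vectors. -/
lemma RE.of_forall_signedSingle {G H : Matrix q q ℝ} (hG : G.IsSymm) {b τ : ℝ} (hb : 0 < b)
    (hH : ∀ v, b * ∑ i, v i ^ 2 ≤ v ⬝ᵥ (H *ᵥ v)) {m : ℕ} (hm : 2 ≤ m)
    (hlow : ∀ f : Fin m → q × Bool, ∀ w, w = ∑ k, signedSingle (f k) →
      w ⬝ᵥ (H *ᵥ w) - b / 4 * ∑ i, w i ^ 2 ≤ w ⬝ᵥ (G *ᵥ w))
    (hupp : ∀ j, G j j ≤ H j j + b / 4) (hτ : b / (2 * (m - 1)) ≤ τ) : RE G (b / 2) τ where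
  symm := hG
  curvature_pos := by positivity
  tolerance_nonneg := by
    have : (2 : ℝ) ≤ m := by exact_mod_cast hm
    exact (div_nonneg hb.le (by linarith)).trans hτ
  lower θ := by
    have hm1 : (0 : ℝ) < m - 1 := by
      have : (2 : ℝ) ≤ m := by exact_mod_cast hm
      linarith
    have hq : ∀ v, v ⬝ᵥ ((G - H + (b / 4) • (1 : Matrix q q ℝ)) *ᵥ v) =
        v ⬝ᵥ (G *ᵥ v) - v ⬝ᵥ (H *ᵥ v) + b / 4 * ∑ i, v i ^ 2 := by
      intro v
      rw [Matrix.add_mulVec, Matrix.sub_mulVec, dotProduct_add, dotProduct_sub, Matrix.smul_mulVec,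
        Matrix.one_mulVec, dotProduct_smul, smul_eq_mul]
      simp only [dotProduct, pow_two]
    -- The shift b/4 absorbs the deviation allowed by `hlow`; together with `hupp` the diagonal is
    -- at most b/4 + b/4 = b/2.
    have h := neg_mul_le_of_forall_signedSingle (G - H + (b / 4) • (1 : Matrix q q ℝ))
      (c := b / 2) (by omega : 1 ≤ m) (fun f => by
        rw [hq]
        linarith [hlow f _ rfl]) (fun j => by
        simp only [Matrix.add_apply, Matrix.sub_apply, Matrix.smul_apply, Matrix.one_apply_eq,
          smul_eq_mul, mul_one]
        linarith [hupp j]) θ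
    rw [hq] at h
    set L := (∑ j, |θ j|) ^ 2
    have hL : 0 ≤ L := by positivity
    have h1 : -(b / (2 * (m - 1)) * L) ≤
        θ ⬝ᵥ (G *ᵥ θ) - θ ⬝ᵥ (H *ᵥ θ) + b / 4 * ∑ i, θ i ^ 2 := by
      refine le_of_mul_le_mul_left ?_ hm1
      refine le_trans (le_of_eq ?_) h
      field_simp
    have h2 := mul_le_mul_of_nonneg_right hτ hL
    have h3 := hH θ
    have h4 : 0 ≤ b / 4 * ∑ i, θ i ^ 2 := by positivity
    linarith

/-- For dp = 1 the logarithm vanishes and τ = 0, so the curvature must come from the single entry.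
-/
lemma RE.of_unique {G : Matrix q q ℝ} (j : q) (hj : ∀ i, i = j) {α τ : ℝ}
    (hα : 0 < α) (hτ : 0 ≤ τ) (hG : α ≤ G j j) : RE G α τ where
  symm := by
    ext a c
    rw [Matrix.transpose_apply, hj a, hj c]
  curvature_pos := hα
  tolerance_nonneg := hτ
  lower θ := by
    have huniv : (Finset.univ : Finset q) = {j} := by
      ext i
      simp [hj i]
    simp only [dotProduct, Matrix.mulVec, huniv, Finset.sum_singleton, sq_abs]
    nlinarith [mul_le_mul_of_nonneg_right hG (sq_nonneg (θ j)), mul_nonneg hτ (sq_nonneg (θ j))]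

end Deterministic

/-! ### Union bound and choice of constants -/

section Probability

variable {Ω : Type*} [MeasurableSpace Ω] {P : Measure Ω} [IsProbabilityMeasure P]

/-- Subadditivity is applied to a cover of the whole space, so S need not be measurable. -/
lemma one_sub_le_measureReal_of_compl_subset {κ : Type*} [Fintype κ] {S : Set Ω} {bad : κ → Set Ω}
    {e : ℝ} (hS : ∀ ω, (∀ k, ω ∉ bad k) → ω ∈ S) (hbad : ∀ k, P.real (bad k) ≤ e) :
    1 - Fintype.card κ * e ≤ P.real S := by
  have h1 : P.real (S ∪ ⋃ k, bad k) ≤ P.real S + P.real (⋃ k, bad k) := measureReal_union_le _ _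
  have h2 : S ∪ ⋃ k, bad k = Set.univ := by
    refine Set.eq_univ_of_forall fun ω => ?_
    by_cases h : ∀ k, ω ∉ bad k
    · exact Or.inl (hS ω h)
    · push Not at h
      exact Or.inr (Set.mem_iUnion.2 h)
  have h3 : P.real (⋃ k, bad k) ≤ Fintype.card κ * e := by
    refine (measureReal_iUnion_fintype_le _).trans ?_
    refine (Finset.sum_le_sum fun k _ => hbad k).trans ?_
    simp
  rw [h2, probReal_univ] at h1
  linarith

variable {p d T : ℕ}
  {A : Fin d → Matrix (Fin p) (Fin p) ℝ} {Sig : Matrix (Fin p) (Fin p) ℝ}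
  {X ε : ℤ → Ω → EuclideanSpace ℝ (Fin p)}

lemma isSymm_gram (d T : ℕ) (x : ℤ → EuclideanSpace ℝ (Fin p)) : (gram d T x).IsSymm := by
  rw [Matrix.IsSymm, gram, Matrix.transpose_smul, Matrix.transpose_mul, Matrix.transpose_transpose]

lemma dotProduct_gram_mulVec_nonneg (d T : ℕ) (x : ℤ → EuclideanSpace ℝ (Fin p))
    (v : Fin d × Fin p → ℝ) : 0 ≤ v ⬝ᵥ (gram d T x *ᵥ v) := by
  rw [dotProduct_gram_mulVec]
  positivity

/-- Counts the sums of m signed atoms: 2n ≤ n² and m ≤ y + 2 ≤ 3y. -/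
lemma two_mul_pow_le_exp {n m : ℕ} (hn : 2 ≤ n) {y : ℝ} (hy : 1 ≤ y) (hm : (m : ℝ) ≤ y + 2) :
    (2 * (n : ℝ)) ^ m ≤ Real.exp (6 * (y * Real.log n)) := by
  have hn0 : (0 : ℝ) < n := by positivity
  have hn2 : (2 : ℝ) ≤ n := by exact_mod_cast hn
  have hlog : 0 ≤ Real.log n := Real.log_nonneg (by linarith)
  have h1 : 2 * (n : ℝ) ≤ Real.exp (2 * Real.log n) := by
    rw [two_mul (Real.log n), Real.exp_add, Real.exp_log hn0]
    gcongr
  calc (2 * (n : ℝ)) ^ m ≤ Real.exp (2 * Real.log n) ^ m := by gcongr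
    _ = Real.exp (m * (2 * Real.log n)) := by rw [← Real.exp_nat_mul]
    _ ≤ _ := by
      refine Real.exp_le_exp.2 ?_
      have h2 : (m : ℝ) * (2 * Real.log n) ≤ (3 * y) * (2 * Real.log n) := by
        gcongr
        linarith
      linarith

/-- The restricted eigenvalue condition for the Gram matrix itself. -/
theorem IsVARProcess.le_measureReal_RE_gram (hp : 1 ≤ p) (hd : 1 ≤ d) (hT : d ≤ T)
    (hA : IsStable A) (hSig : Sig.PosDef) (hX : IsVARProcess A Sig X ε P) :
    1 - 2 * Real.exp (-(6 * numSamples d T *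
        min ((omegaVAR 40 A hSig.isHermitian ^ 2)⁻¹) 1)) ≤
      P.real {ω | RE (gram d T (fun t => X t ω)) (alphaVAR A hSig.isHermitian)
        (tauVAR 40 T A hSig.isHermitian)} := by
  have : Nonempty (Fin p) := ⟨⟨0, hp⟩⟩
  have hbB := hX.lambdaMin_div_muMax_le (T := T) hp hd hT hA hSig
  have hb : 0 < lambdaMin hSig.isHermitian / muMax A :=
    div_pos (lambdaMin_pos hp hSig) (muMax_pos hA)
  have hmean := hX.lambdaMin_mul_le_meanGram hp hd hT hA hSig
  have hconc := fun v => hX.gram_concentration hp hd hT hA hSig v (T := T)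
    (η := (lambdaMin hSig.isHermitian / muMax A) /
      (4 * (lambdaMax hSig.isHermitian / muMin (companionVAR A))))
    (div_nonneg hb.le (mul_nonneg zero_le_four (hb.le.trans hbB))) (by
      rw [div_le_one (by linarith)]
      linarith)
  have hα : alphaVAR A hSig.isHermitian = (lambdaMin hSig.isHermitian / muMax A) / 2 := by
    rw [alphaVAR, div_div, mul_comm]
  have hlog : Real.log d + Real.log p = Real.log ((d * p : ℕ) : ℝ) := by
    rw [Nat.cast_mul, Real.log_mul (by positivity) (by positivity)]
  have hN := numSamples_pos d T
  rw [tauVAR, hlog, hα, omegaVAR]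
  set b := lambdaMin hSig.isHermitian / muMax A
  set B := lambdaMax hSig.isHermitian / muMin (companionVAR A)
  set N : ℝ := (numSamples d T : ℝ)
  have hB : 0 < B := hb.trans_le hbB
  have hηB : b / (4 * B) * B = b / 4 := by field_simp
  rw [hηB] at hconc
  -- Each bad event has probability at most exp(-x/128), and x = 1600 N/ω² because 40² = 1600.
  set x : ℝ := N * (b / B) ^ 2 with hx
  have hx0 : 0 < x := by positivity
  have hexp : N * (b / (4 * B)) ^ 2 / 8 = x / 128 := by
    rw [hx]; field_simp; ring
  rw [hexp] at hconc
  set ω₂ : ℝ := (40 * (B / b)) ^ 2 with hω₂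
  have hω₂pos : 0 < ω₂ := by positivity
  have hxω : x = 1600 * (N / ω₂) := by
    rw [hx, hω₂]; field_simp; norm_num
  have htarget : Real.exp (-(6 * (x / 1600))) ≤ Real.exp (-(6 * N * min ω₂⁻¹ 1)) := by
    refine Real.exp_le_exp.2 (neg_le_neg ?_)
    rw [hxω, mul_div_cancel_left₀ _ (by norm_num), mul_assoc, div_eq_mul_inv]
    gcongr
    exact min_le_left _ _
  have hα0 : 0 < b / 2 := by positivity
  have hdp : 1 ≤ d * p := Nat.mul_pos hd hp
  rcases hdp.eq_or_lt with h1 | h2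
  · have hd1 : d = 1 := Nat.eq_one_of_mul_eq_one_right h1.symm
    have hp1 : p = 1 := Nat.eq_one_of_mul_eq_one_left h1.symm
    set j : Fin d × Fin p := (⟨0, hd⟩, ⟨0, hp⟩)
    have hj : ∀ i : Fin d × Fin p, i = j := by
      rintro ⟨a, c⟩
      ext <;> simp [j] <;> omega
    have h := one_sub_le_measureReal_of_compl_subset (P := P) (κ := Unit)
      (S := {ω | RE (gram d T (fun t => X t ω)) (b / 2)
        (b / 2 * max ω₂ 1 * (Real.log ((d * p : ℕ) : ℝ) / N))})
      (bad := fun _ => _) (fun ω hω => ?_) (fun _ => (hconc (Pi.single j 1)).1)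
    · refine le_trans ?_ h
      have h3 : Real.exp (-(x / 128)) ≤ Real.exp (-(6 * (x / 1600))) :=
        Real.exp_le_exp.2 (by linarith)
      have h4 := Real.exp_pos (-(6 * N * min ω₂⁻¹ 1))
      simp only [Fintype.card_unit, Nat.cast_one, one_mul]
      linarith
    · have h5 := hω ()
      have h6 := hmean (Pi.single j 1)
      rw [Set.mem_ofPred_eq, not_lt] at h5
      rw [sum_single_sq, dotProduct_mulVec_single] at h5 h6
      rw [dotProduct_mulVec_single] at h5
      refine RE.of_unique j hj hα0 ?_ (by linarith)
      rw [← h1]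
      simp
  · set ℓ := Real.log ((d * p : ℕ) : ℝ) with hℓ
    have hℓ0 : 0 < ℓ := Real.log_pos (by exact_mod_cast h2)
    -- Chosen so that α/y ≤ τ. If y ≤ 1 then τ ≥ α and RE holds surely.
    set y : ℝ := N / ω₂ / ℓ with hy
    have hτ : b / 2 / y ≤ b / 2 * max ω₂ 1 * (ℓ / N) := by
      have : b / 2 / y = b / 2 * ω₂ * (ℓ / N) := by rw [hy]; field_simp
      rw [this]
      gcongr
      exact le_max_left _ _
    have hy0 : 0 < y := by positivity
    rcases le_or_gt y 1 with hy1 | hy1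
    · have hall : {ω | RE (gram d T (fun t => X t ω)) (b / 2) (b / 2 * max ω₂ 1 * (ℓ / N))} =
          Set.univ := Set.eq_univ_of_forall fun ω =>
        RE.of_le (isSymm_gram _ _ _) (dotProduct_gram_mulVec_nonneg _ _ _) hα0
          (le_trans (by rw [le_div_iff₀ hy0]; nlinarith) hτ)
      rw [hall, probReal_univ]
      linarith [Real.exp_pos (-(6 * N * min ω₂⁻¹ 1))]
    -- Then m - 1 ≥ y, so the sparsification error b/(2(m-1)) is at most τ, while m ≤ y + 2 keeps
    -- the number of events at most 2 exp(6x/1600).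
    · set m : ℕ := ⌈y⌉₊ + 1 with hm
      have hm1 : y ≤ (m : ℝ) - 1 := by
        rw [hm]; push_cast; linarith [Nat.le_ceil y]
      have hm2 : (m : ℝ) ≤ y + 2 := by
        rw [hm]; push_cast; linarith [Nat.ceil_lt_add_one hy0.le]
      have hm3 : 2 ≤ m := by
        have : 0 < ⌈y⌉₊ := Nat.ceil_pos.2 hy0
        omega
      have h := one_sub_le_measureReal_of_compl_subset (P := P)
        (κ := (Fin m → (Fin d × Fin p) × Bool) ⊕ (Fin d × Fin p))
        (S := {ω | RE (gram d T (fun t => X t ω)) (b / 2) (b / 2 * max ω₂ 1 * (ℓ / N))})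
        (bad := Sum.elim
          (fun f => {ω | (∑ k, signedSingle (f k)) ⬝ᵥ
            (gram d T (fun t => X t ω) *ᵥ ∑ k, signedSingle (f k)) <
              (∑ k, signedSingle (f k)) ⬝ᵥ (meanGram d T X P *ᵥ ∑ k, signedSingle (f k)) -
                b / 4 * ∑ a, (∑ k, signedSingle (f k)) a ^ 2})
          (fun j => {ω | Pi.single j 1 ⬝ᵥ (meanGram d T X P *ᵥ Pi.single j 1) +
            b / 4 * ∑ a, (Pi.single j 1 : Fin d × Fin p → ℝ) a ^ 2 <
              Pi.single j 1 ⬝ᵥ (gram d T (fun t => X t ω) *ᵥ Pi.single j 1)}))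
        (e := Real.exp (-(x / 128))) (fun ω hω => ?_) ?_
      · refine le_trans ?_ h
        have hpow := two_mul_pow_le_exp h2 hy1.le hm2
        have hyx : 6 * (y * Real.log ((d * p : ℕ) : ℝ)) = 6 * (x / 1600) := by
          rw [← hℓ, hy, hxω]; field_simp
        rw [hyx] at hpow
        have hdp1 : (1 : ℝ) ≤ ((d * p : ℕ) : ℝ) := by exact_mod_cast hdp
        have hle : ((d * p : ℕ) : ℝ) ≤ (2 * ((d * p : ℕ) : ℝ)) ^ m := by
          calc ((d * p : ℕ) : ℝ) ≤ 2 * ((d * p : ℕ) : ℝ) := by linarith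
            _ ≤ _ := le_self_pow₀ (by linarith) (by omega)
        have hcount : (Fintype.card ((Fin m → (Fin d × Fin p) × Bool) ⊕ (Fin d × Fin p)) : ℝ) ≤
            2 * Real.exp (6 * (x / 1600)) := by
          have : (Fintype.card ((Fin m → (Fin d × Fin p) × Bool) ⊕ (Fin d × Fin p)) : ℝ) =
              (2 * ((d * p : ℕ) : ℝ)) ^ m + ((d * p : ℕ) : ℝ) := by
            simp [mul_comm]
          rw [this]
          linarith
        have hfinal : (Fintype.card ((Fin m → (Fin d × Fin p) × Bool) ⊕ (Fin d × Fin p)) : ℝ) *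
            Real.exp (-(x / 128)) ≤ 2 * Real.exp (-(6 * N * min ω₂⁻¹ 1)) := by
          calc _ ≤ 2 * Real.exp (6 * (x / 1600)) * Real.exp (-(x / 128)) := by gcongr
            _ = 2 * Real.exp (6 * (x / 1600) + -(x / 128)) := by rw [Real.exp_add]; ring
            -- Here 12/1600 ≤ 1/128: half of the 12 pays for the number of events, the other half is
            -- the final rate.
            _ ≤ 2 * Real.exp (-(6 * (x / 1600))) := by
              gcongr
              linarith
            _ ≤ _ := by gcongr
        linarith
      · refine RE.of_forall_signedSingle (H := meanGram d T X P) (isSymm_gram _ _ _) hb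
          hmean hm3 ?_ ?_ ?_
        · rintro f w rfl
          have := hω (Sum.inl f)
          rwa [Sum.elim_inl, Set.mem_ofPred_eq, not_lt] at this
        · intro j
          have := hω (Sum.inr j)
          rwa [Sum.elim_inr, Set.mem_ofPred_eq, not_lt, sum_single_sq, dotProduct_mulVec_single,
            dotProduct_mulVec_single, mul_one] at this
        · refine le_trans ?_ hτ
          rw [div_div b 2 y]
          exact div_le_div_of_nonneg_left hb.le (by positivity) (by linarith)
      · rintro (f | j)
        · exact (hconc _).1
        · exact (hconc _).2

end Probability

lemma rowMargin_one {p : ℕ} (i : Fin p) : rowMargin (1 : Matrix (Fin p) (Fin p) ℝ) i = 1 := by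
  rw [rowMargin, Matrix.one_apply_eq, Finset.sum_eq_zero, sub_zero]
  intro j hj
  rw [Matrix.one_apply_ne (Finset.ne_of_mem_erase hj).symm, abs_zero]

end SparseVAR

theorem proposition4p2 :
    ∃ c₀ c₁ c₂ c₃ : ℝ, 0 < c₀ ∧ 0 < c₁ ∧ 0 < c₂ ∧ 0 < c₃ ∧
      ∀ (p d T k : ℕ) (_hp : 1 ≤ p) (_hd : 1 ≤ d) (_hT : d ≤ T)
        (A : Fin d → Matrix (Fin p) (Fin p) ℝ) (_hA : SparseVAR.IsStable A)
        (_hk : SparseVAR.sparsity A = k)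
        (Sig : Matrix (Fin p) (Fin p) ℝ) (hSig : Sig.PosDef)
        (Ω : Type*) [MeasurableSpace Ω] (P : Measure Ω) [IsProbabilityMeasure P]
        (X ε : ℤ → Ω → EuclideanSpace ℝ (Fin p))
        (_hX : SparseVAR.IsVARProcess A Sig X ε P)
        (_hN : c₀ * (max (SparseVAR.omegaVAR c₃ A hSig.isHermitian ^ 2) 1 * k *
            (Real.log d + Real.log p)) ≤ (SparseVAR.numSamples d T : ℝ)),
        1 - c₁ * Real.exp (-(c₂ * SparseVAR.numSamples d T *
              min ((SparseVAR.omegaVAR c₃ A hSig.isHermitian ^ 2)⁻¹) 1)) ≤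
          P.real {ω | SparseVAR.RE
            ((1 : Matrix (Fin p) (Fin p) ℝ) ⊗ₖ SparseVAR.gram d T (fun t => X t ω))
            (SparseVAR.alphaVAR A hSig.isHermitian)
            (SparseVAR.tauVAR c₃ T A hSig.isHermitian)} ∧
        ((∀ i, 0 < SparseVAR.rowMargin Sig⁻¹ i) →
          1 - c₁ * Real.exp (-(c₂ * SparseVAR.numSamples d T *
                min ((SparseVAR.omegaVAR c₃ A hSig.isHermitian ^ 2)⁻¹) 1)) ≤
            P.real {ω | SparseVAR.RE
              (Sig⁻¹ ⊗ₖ SparseVAR.gram d T (fun t => X t ω))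
              (SparseVAR.alphaVAR A hSig.isHermitian * ⨅ i, SparseVAR.rowMargin Sig⁻¹ i)
              (SparseVAR.tauVAR c₃ T A hSig.isHermitian *
                ⨆ i, SparseVAR.rowMargin Sig⁻¹ i)}) := by
  -- The values 2, 6 and 40 are the prefactor, rate and scale of
  -- `IsVARProcess.le_measureReal_RE_gram`.
  refine ⟨1, 2, 6, 40, one_pos, two_pos, by norm_num, by norm_num, ?_⟩
  intro p d T k hp hd hT A hA _ Sig hSig Ω _ P _ X ε hX _
  have : Nonempty (Fin p) := ⟨⟨0, hp⟩⟩
  have h := hX.le_measureReal_RE_gram hp hd hT hA hSig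
  refine ⟨h.trans (measureReal_mono fun ω hω => ?_),
    fun hmargin => h.trans (measureReal_mono fun ω hω => ?_)⟩
  -- All margins of the identity are 1, so α and τ are unchanged.
  · have h1 := SparseVAR.RE.kronecker (W := (1 : Matrix (Fin p) (Fin p) ℝ)) Matrix.isSymm_one
      (fun i => by rw [SparseVAR.rowMargin_one]; exact one_pos)
      (SparseVAR.dotProduct_gram_mulVec_nonneg _ _ _) hω
    rw [Set.mem_ofPred_eq]
    simpa only [SparseVAR.rowMargin_one, ciInf_const, ciSup_const, mul_one] using h1
  · have hsymm : (Sig⁻¹).IsSymm := by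
      have h2 : Sigᵀ = Sig := by
        have := hSig.isHermitian.eq
        rwa [Matrix.conjTranspose_eq_transpose_of_trivial] at this
      rw [Matrix.IsSymm, Matrix.transpose_nonsing_inv, h2]
    exact SparseVAR.RE.kronecker hsymm hmargin
      (SparseVAR.dotProduct_gram_mulVec_nonneg _ _ _) hω
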